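/- Let $n\ge 3$ be odd. Let $\mathcal P_n$ be the partition monoid, i.e. the set of all set partitions of $\{1,\dots,n\}\cup\{1',\dots,n'\}$ (upper vertices $x$, lower vertices $x'$), where the product $\alpha\beta$ is obtained by stacking $\alpha$ above $\beta$, identifying the lower vertices of $\alpha$ with the upper vertices of $\beta$, and letting two outer vertices lie in the same block of $\alpha\beta$ iff they lie in the same connected component of the resulting graph. The Brauer monoid $\mathcal B_n$ is the submonoid of $\mathcal P_n$ of all partitions whose blocks all have size $2$. The rank of a partition is its number of blocks containing both upper and lower vertices, and $\alpha^*$ is obtained from $\alpha$ by interchanging $x$ and $x'$ for all $x$. For $r\ge 0$ put $$D_r=\{\alpha\in\mathcal B_n:\operatorname{rank}(\alpha)=r\},\qquad p_r=\bigl|\{\varepsilon\in D_r:\varepsilon^2=\varepsilon=\varepsilon^*\}\bigr|.$$ Let $\zeta\in\mathcal B_n$ have the blocks $\{1,1'\}$ and $\{2i,2i+1\}$, $\{(2i)',(2i+1)'\}$ for $1\le i\le (n-1)/2$. Write $a\le_{\mathscr R} b$ if $a\in b\mathcal B_n$, and let $R=\{a\in\mathcal B_n : a\le_{\mathscr R}\zeta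 \text{ and } \zeta\le_{\mathscr R}a\}$ be the $\mathscr R$-class of $\zeta$. Let $$T=\{a\in\mathcal B_n : aR\subseteq R\},\qquad K=\{a\in\mathcal B_n:\zeta\le_{\mathscr R}a\},\qquad I=\mathcal B_n\setminus K,\qquad U=T\cap\mathcal S_n,$$ where $\mathcal S_n$ is the group of units of $\mathcal B_n$. Let $\mathcal R_I$ be the Rees right congruence of the right ideal $I$ ($a,b$ are related iff $a=b$ or $a,b\in I$), let $\mathscr L^U$ be the right congruence relating $a,b$ iff $Ua=Ub$, and let $\sigma=\mathcal R_I\vee\mathscr L^U$ be their join in the lattice of equivalence relations on $\mathcal B_n$; it is a right congruence, so $\mathcal B_n$ acts on $\mathcal B_n/\sigma$ by $[\alpha]_\sigma\cdot\beta=[\alpha\beta]_\sigma$. Let $\Omega=\{[\alpha]_\sigma:\alpha\in D_1\cup D_3\}$. Then $\Omega$ is closed under this action, and the restricted action $\mu:\Omega\times\mathcal B_n\to\Omega$, $\mu([\alpha]_\sigma,\beta)=[\alpha\beta]_\sigma$, is faithful (if $\mu(\omega,\beta)=\mu(\omega,\gamma)$ for all $\omega\in\Omega$, then $\beta=\gamma$)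 and monogenic (for some $\omega\in\Omega$, $\Omega=\{\omega\}\cup\{\mu(\omega,\beta):\beta\in\mathcal B_n\}$). Moreover, $$\deg(\mathcal B_n)\le\deg_{\mathrm{rc}}(\mathcal B_n)\le 1+3p_3+p_1,$$ where, for a finite semigroup $S$, $\deg(S)$ is the least $d\ge 1$ such that $S$ embeds in the monoid of all self-maps of a $d$-element set, composed left to right, and $\deg_{\mathrm{rc}}(S)$ is the least $d\ge1$ such that $S$ has a faithful right action on a $d$-element set that is isomorphic to the action of $S$ on $S/\tau$ by $[x]_\tau\cdot a=[xa]_\tau$ for some right congruence $\tau$ of $S$. -/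

import Mathlib

namespace DiagramMonoid

/-! ### Right actions of semigroups and transformation degrees -/

section Actions

/-- A right action of a semigroup `S` on a set `X`. -/
structure RightAction (S : Type*) [Semigroup S] (X : Type*) where
  act : X → S → X
  act_act : ∀ (x : X) (a b : S), act (act x a) b = act x (a * b)

variable {S : Type*} [Semigroup S] {X Y : Type*}

namespace RightAction

/-- The kernel of the associated transformation representation is trivial. -/
def Faithful (μ : RightAction S X) : Prop :=
  ∀ a b : S, (∀ x : X, μ.act x a = μ.act x b) → a = b

/-- The sub-act generated by a set `A` of points. -/
def generated (μ : RightAction S X) (A : Set X) : Set X :=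
  A ∪ {y | ∃ x ∈ A, ∃ a : S, y = μ.act x a}

/-- The whole set is generated, as a sub-act, by one point. -/
def Monogenic (μ : RightAction S X) : Prop :=
  ∃ x : X, μ.generated {x} = Set.univ

/-- `A` is a sub-act: it is closed under the action. -/
def IsSubAct (μ : RightAction S X) (A : Set X) : Prop :=
  ∀ x ∈ A, ∀ a : S, μ.act x a ∈ A

/-- The restriction of an action to a sub-act. -/
def restrict (μ : RightAction S X) (A : Set X) (hA : μ.IsSubAct A) : RightAction S A where
  act x a := ⟨μ.act x.1 a, hA x.1 x.2 a⟩
  act_act x a b := Subtype.ext (μ.act_act x.1 a b)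

/-- Isomorphism of actions. -/
def Isomorphic (μ : RightAction S X) (ν : RightAction S Y) : Prop :=
  ∃ ξ : X ≃ Y, ∀ (x : X) (a : S), ξ (μ.act x a) = ν.act (ξ x) a

end RightAction

/-- A right congruence: an equivalence relation compatible with right multiplication. -/
structure RightCongruence (S : Type*) [Semigroup S] where
  rel : Setoid S
  right_compat : ∀ a b s : S, rel a b → rel (a * s) (b * s)

namespace RightCongruence

/-- The set `S/σ` of classes. -/
abbrev Classes (σ : RightCongruence S) : Type _ := Quotient σ.rel

/-- The class `[a]_σ`. -/
def cls (σ : RightCongruence S) (a : S) : σ.Classes := Quotient.mk σ.rel a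

/-- The action `[x]_σ · a = [x a]_σ` of `S` on `S/σ`. -/
def action (σ : RightCongruence S) : RightAction S σ.Classes where
  act x a := Quotient.map (fun y : S => y * a) (fun y z h => σ.right_compat y z a h) x
  act_act x a b := by
    induction x using Quotient.inductionOn with
    | h y => exact congrArg (Quotient.mk σ.rel) (mul_assoc y a b)

/-- The join, taken in the lattice of equivalence relations. -/
def join (σ τ : RightCongruence S) : RightCongruence S where
  rel := σ.rel ⊔ τ.rel
  right_compat a b s h := by
    have key : σ.rel ⊔ τ.rel ≤ Setoid.comap (fun x => x * s) (σ.rel ⊔ τ.rel) := by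
      refine sup_le ?_ ?_
      · intro x y hxy
        exact (le_sup_left : σ.rel ≤ σ.rel ⊔ τ.rel) (σ.right_compat x y s hxy)
      · intro x y hxy
        exact (le_sup_right : τ.rel ≤ σ.rel ⊔ τ.rel) (τ.right_compat x y s hxy)
    exact key h

/-- The Rees right congruence of a right ideal `I`. -/
def rees (I : Set S) (hI : ∀ a ∈ I, ∀ s : S, a * s ∈ I) : RightCongruence S where
  rel :=
    { r := fun a b => a = b ∨ (a ∈ I ∧ b ∈ I)
      iseqv :=
        { refl := fun _ => Or.inl rfl
          symm := by
            rintro a b (h | ⟨h1, h2⟩)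
            · exact Or.inl h.symm
            · exact Or.inr ⟨h2, h1⟩
          trans := by
            rintro a b c (rfl | ⟨h1, h2⟩) (rfl | ⟨h3, h4⟩)
            · exact Or.inl rfl
            · exact Or.inr ⟨h3, h4⟩
            · exact Or.inr ⟨h1, h2⟩
            · exact Or.inr ⟨h1, h4⟩ } }
  right_compat a b s h := by
    rcases h with h | ⟨h1, h2⟩
    · exact Or.inl (congrArg (fun x => x * s) h)
    · exact Or.inr ⟨hI a h1 s, hI b h2 s⟩

end RightCongruence

/-- An action isomorphic to the action on the classes of some right congruence. -/
def RightAction.IsRightCongruenceAction (μ : RightAction S X) : Prop :=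
  ∃ σ : RightCongruence S, μ.Isomorphic σ.action

/-- The minimum transformation degree: the least `d ≥ 1` such that `S` embeds in the monoid of
self-maps of a `d`-element set, composed left to right (hence the opposite of `Function.End`).
The value is `⊤` if there is no such `d`. -/
noncomputable def deg (S : Type*) [Semigroup S] : ℕ∞ :=
  sInf {m : ℕ∞ | ∃ d : ℕ, 1 ≤ d ∧ m = (d : ℕ∞) ∧
    ∃ φ : S →ₙ* (Function.End (Fin d))ᵐᵒᵖ, Function.Injective φ}

/-- The minimum right congruence degree: the least `d ≥ 1` such that `S` has a faithful right
congruence action on a `d`-element set. The value is `⊤` if there is no such `d`. -/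
noncomputable def degRC (S : Type*) [Semigroup S] : ℕ∞ :=
  sInf {m : ℕ∞ | ∃ d : ℕ, 1 ≤ d ∧ m = (d : ℕ∞) ∧
    ∃ μ : RightAction S (Fin d), μ.IsRightCongruenceAction ∧ μ.Faithful}

end Actions

/-! ### Green's relations and the right congruence built from an `R`-class -/

section Green

variable {M : Type*} [Monoid M]

/-- Green's preorder: `a ≤_R b` iff `a ∈ b M`. -/
def LeR (a b : M) : Prop := ∃ s : M, a = b * s

/-- The `R`-class of `z`: all `a` with `a M = z M`. -/
def RClass (z : M) : Set M := {a | LeR a z ∧ LeR z a}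

/-- `T = {a | a R ⊆ R}` for the `R`-class `R` of `z`; it is a submonoid. -/
def setT (z : M) : Submonoid M where
  carrier := {a | ∀ x ∈ RClass z, a * x ∈ RClass z}
  one_mem' x hx := by rwa [one_mul]
  mul_mem' {a b} ha hb x hx := by
    rw [mul_assoc]
    exact ha _ (hb x hx)

/-- `K = {a | R ≤ R_a}` for the `R`-class `R` of `z`. -/
def setK (z : M) : Set M := {a | LeR z a}

/-- `I` is the complement of `K`. -/
def setI (z : M) : Set M := (setK z)ᶜ

theorem setI_mul_mem (z : M) : ∀ a ∈ setI z, ∀ s : M, a * s ∈ setI z := by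
  rintro a ha s ⟨t, ht⟩
  exact ha ⟨s * t, by rw [ht, mul_assoc]⟩

/-- Green's relative `L` relation: `a` and `b` are related iff `U a = U b`. (As `U` contains the
identity, `U` is its own monoid completion.) -/
def relativeL (U : Submonoid M) : RightCongruence M where
  rel :=
    { r := fun a b => {x | ∃ u ∈ U, x = u * a} = {x | ∃ u ∈ U, x = u * b}
      iseqv := ⟨fun _ => rfl, fun h => h.symm, fun h1 h2 => h1.trans h2⟩ }
  right_compat a b s h := by
    have h' : {x | ∃ u ∈ U, x = u * a} = {x | ∃ u ∈ U, x = u * b} := h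
    have image : ∀ c : M,
        {x | ∃ u ∈ U, x = u * (c * s)} = (fun y => y * s) '' {x | ∃ u ∈ U, x = u * c} := by
      intro c
      ext x
      constructor
      · rintro ⟨u, hu, rfl⟩
        exact ⟨u * c, ⟨u, hu, rfl⟩, mul_assoc u c s⟩
      · rintro ⟨y, ⟨u, hu, rfl⟩, rfl⟩
        exact ⟨u, hu, mul_assoc u c s⟩
    change {x | ∃ u ∈ U, x = u * (a * s)} = {x | ∃ u ∈ U, x = u * (b * s)}
    rw [image a, image b, h']

end Green

/-! ### The partition monoid -/

/-- The vertices of a diagram: `Sum.inl x` is the upper vertex `x`, and `Sum.inr x` is the lower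
vertex `x'`. -/
abbrev Vertex (n : ℕ) : Type := Fin n ⊕ Fin n

/-- A set partition of the vertices, given by the relation "in the same block". -/
@[ext]
structure PartitionDiagram (n : ℕ) where
  rel : Setoid (Vertex n)

/-- The vertices of a product graph: upper row, middle row and lower row. -/
abbrev Vertex3 (n : ℕ) : Type := Fin n ⊕ Fin n ⊕ Fin n

namespace PartitionDiagram

variable {n : ℕ}

/-- The first factor of a product occupies the upper and middle rows. -/
def onTop : Vertex n → Vertex3 n
  | Sum.inl x => Sum.inl x
  | Sum.inr x => Sum.inr (Sum.inl x)

/-- The second factor of a product occupies the middle and lower rows. -/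
def onBottom : Vertex n → Vertex3 n
  | Sum.inl x => Sum.inr (Sum.inl x)
  | Sum.inr x => Sum.inr (Sum.inr x)

/-- The product itself is read off the upper and lower rows. -/
def outer : Vertex n → Vertex3 n
  | Sum.inl x => Sum.inl x
  | Sum.inr x => Sum.inr (Sum.inr x)

/-- The edges of the product graph. -/
inductive ProductEdge (α β : PartitionDiagram n) : Vertex3 n → Vertex3 n → Prop
  | top (a b : Vertex n) (h : α.rel a b) : ProductEdge α β (onTop a) (onTop b)
  | bottom (a b : Vertex n) (h : β.rel a b) : ProductEdge α β (onBottom a) (onBottom b)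

/-- Two outer vertices are in the same block of the product iff they are in the same connected
component of the product graph. -/
instance : Mul (PartitionDiagram n) where
  mul α β := ⟨Setoid.comap outer (Relation.EqvGen.setoid (ProductEdge α β))⟩

/-- The identity diagram, with blocks `{x, x'}`. -/
instance : One (PartitionDiagram n) where
  one := ⟨Setoid.ker (Sum.elim id id)⟩

theorem mul_rel (α β : PartitionDiagram n) (a b : Vertex n) :
    (α * β).rel a b ↔ Relation.EqvGen (ProductEdge α β) (outer a) (outer b) := Iff.rfl

theorem one_rel (a b : Vertex n) :
    (1 : PartitionDiagram n).rel a b ↔ Sum.elim id id a = Sum.elim id id b := Iff.rfl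

/-- The union of the set `u` of upper vertices and the set `l` of lower vertices is a union of
blocks of `α`. -/
def Sat (α : PartitionDiagram n) (u l : Fin n → Prop) : Prop :=
  ∀ a b, α.rel a b → (Sum.elim u l a ↔ Sum.elim u l b)

theorem ext_sat {α β : PartitionDiagram n} (h : ∀ u l, α.Sat u l ↔ β.Sat u l) : α = β := by
  have key : ∀ α β : PartitionDiagram n, (∀ u l, β.Sat u l → α.Sat u l) →
      ∀ a b, α.rel a b → β.rel a b := by
    intro α β h a b hab
    have e : Sum.elim (fun x => β.rel a (Sum.inl x)) (fun x => β.rel a (Sum.inr x))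
        = fun v => β.rel a v := by
      funext v; cases v <;> rfl
    have hs : β.Sat (fun x => β.rel a (Sum.inl x)) (fun x => β.rel a (Sum.inr x)) := by
      intro c d hcd
      rw [e]
      exact ⟨fun hc => β.rel.trans' hc hcd, fun hd => β.rel.trans' hd (β.rel.symm' hcd)⟩
    have h2 := h _ _ hs a b hab
    rw [e] at h2
    exact h2.1 (β.rel.refl' a)
  ext a b
  exact ⟨key α β (fun u l => (h u l).2) a b, key β α (fun u l => (h u l).1) a b⟩

theorem sat_mul (α β : PartitionDiagram n) (u l : Fin n → Prop) :
    (α * β).Sat u l ↔ ∃ m, α.Sat u m ∧ β.Sat m l := by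
  constructor
  · intro h
    let C : Vertex3 n → Prop := fun w =>
      ∃ x, Relation.EqvGen (ProductEdge α β) (outer x) w ∧ Sum.elim u l x
    have hC : ∀ w w', ProductEdge α β w w' → (C w ↔ C w') := by
      intro w w' hw
      constructor
      · rintro ⟨x, hx, hx'⟩
        exact ⟨x, .trans _ _ _ hx (.rel _ _ hw), hx'⟩
      · rintro ⟨x, hx, hx'⟩
        exact ⟨x, .trans _ _ _ hx (.symm _ _ (.rel _ _ hw)), hx'⟩
    have hO : ∀ x, C (outer x) ↔ Sum.elim u l x := by
      intro x
      constructor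
      · rintro ⟨y, hy, hy'⟩
        exact (h y x hy).1 hy'
      · intro hx
        exact ⟨x, .refl _, hx⟩
    refine ⟨fun m => C (Sum.inr (Sum.inl m)), ?_, ?_⟩
    · have e : ∀ a, Sum.elim u (fun m => C (Sum.inr (Sum.inl m))) a ↔ C (onTop a) := by
        rintro (a | a)
        · exact (hO (Sum.inl a)).symm
        · exact Iff.rfl
      intro a b hab
      rw [e, e]
      exact hC _ _ (.top a b hab)
    · have e : ∀ a, Sum.elim (fun m => C (Sum.inr (Sum.inl m))) l a ↔ C (onBottom a) := by
        rintro (a | a)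
        · exact Iff.rfl
        · exact (hO (Sum.inr a)).symm
      intro a b hab
      rw [e, e]
      exact hC _ _ (.bottom a b hab)
  · rintro ⟨m, h1, h2⟩ a b hab
    let C : Vertex3 n → Prop := Sum.elim u (Sum.elim m l)
    have hC : ∀ w w', Relation.EqvGen (ProductEdge α β) w w' → (C w ↔ C w') := by
      intro w w' hw
      induction hw with
      | rel x y hxy =>
        cases hxy with
        | top a b h =>
          have := h1 a b h
          cases a <;> cases b <;> exact this
        | bottom a b h =>
          have := h2 a b h
          cases a <;> cases b <;> exact this
      | refl x => exact Iff.rfl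
      | symm x y _ ih => exact ih.symm
      | trans x y z _ _ ih1 ih2 => exact ih1.trans ih2
    have := hC _ _ hab
    cases a <;> cases b <;> exact this

theorem sat_one (u l : Fin n → Prop) : (1 : PartitionDiagram n).Sat u l ↔ u = l := by
  constructor
  · intro h
    funext x
    exact propext (h (Sum.inl x) (Sum.inr x) rfl)
  · rintro rfl a b hab
    have hab' : Sum.elim id id a = Sum.elim id id b := hab
    cases a <;> cases b <;> simp_all

instance : Monoid (PartitionDiagram n) where
  mul_assoc α β γ := by
    refine ext_sat fun u l => ?_
    simp only [sat_mul]
    constructor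
    · rintro ⟨m, ⟨m', h1, h2⟩, h3⟩
      exact ⟨m', h1, m, h2, h3⟩
    · rintro ⟨m', h1, m, h2, h3⟩
      exact ⟨m, ⟨m', h1, h2⟩, h3⟩
  one_mul α := by
    refine ext_sat fun u l => ?_
    simp only [sat_mul, sat_one]
    constructor
    · rintro ⟨m, rfl, h⟩
      exact h
    · exact fun h => ⟨u, rfl, h⟩
  mul_one α := by
    refine ext_sat fun u l => ?_
    simp only [sat_mul, sat_one]
    constructor
    · rintro ⟨m, h, rfl⟩
      exact h
    · exact fun h => ⟨l, h, rfl⟩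

/-- The reflection of a diagram in a horizontal axis. -/
def flip (α : PartitionDiagram n) : PartitionDiagram n := ⟨Setoid.comap Sum.swap α.rel⟩

/-- The number of transversals, i.e. of blocks containing both upper and lower vertices. -/
noncomputable def rank (α : PartitionDiagram n) : ℕ :=
  {B ∈ α.rel.classes | (∃ x, Sum.inl x ∈ B) ∧ ∃ y, Sum.inr y ∈ B}.ncard

/-- Every block has size 2. -/
def IsBrauer (α : PartitionDiagram n) : Prop := ∀ B ∈ α.rel.classes, B.ncard = 2

end PartitionDiagram

/-! ### The Brauer monoid -/

section Closure

open PartitionDiagram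

variable {n : ℕ}

theorem isBrauer_iff (α : PartitionDiagram n) :
    α.IsBrauer ↔ ∀ a, ∃ b, b ≠ a ∧ ∀ c, α.rel a c ↔ c = a ∨ c = b := by
  constructor
  · intro h a
    have h2 := h _ (α.rel.mem_classes a)
    obtain ⟨x, y, hxy, he⟩ := Set.ncard_eq_two.1 h2
    have hm : ∀ c, α.rel c a ↔ c = x ∨ c = y := fun c => by
      have : c ∈ {x | α.rel x a} ↔ c ∈ ({x, y} : Set (Vertex n)) := by rw [he]
      simpa using this
    rcases (hm a).1 (α.rel.refl' a) with rfl | rfl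
    · exact ⟨y, hxy.symm, fun c => by rw [α.rel.comm', hm]⟩
    · exact ⟨x, hxy, fun c => by rw [α.rel.comm', hm, or_comm]⟩
  · rintro h B ⟨a, rfl⟩
    obtain ⟨b, hb, hc⟩ := h a
    refine Set.ncard_eq_two.2 ⟨a, b, hb.symm, ?_⟩
    ext c
    have := hc c
    rw [α.rel.comm'] at this
    simpa using this

theorem one_isBrauer : (1 : PartitionDiagram n).IsBrauer := by
  rw [isBrauer_iff]
  rintro (a | a)
  · refine ⟨Sum.inr a, by simp, ?_⟩
    rintro (c | c) <;> simp [eq_comm]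
  · refine ⟨Sum.inl a, by simp, ?_⟩
    rintro (c | c) <;> simp [eq_comm]

/-- In an orbit of two involutions `f`, `g` with no common fixed point, a point fixed by `g` is
accompanied by exactly one other point that is fixed by `f` or `g`. -/
theorem orbit_fixed {W : Type*} [Finite W] (f g : Equiv.Perm W) (hf : ∀ x, f (f x) = x)
    (hg : ∀ x, g (g x) = x) (hfg : ∀ x, ¬ (f x = x ∧ g x = x)) (x : W) (hx : g x = x) :
    ∃ y, y ≠ x ∧ ∀ z, (Relation.EqvGen (fun a b => b = f a ∨ b = g a) x z ∧ (f z = z ∨ g z = z))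
      ↔ z = x ∨ z = y := by
  set h : Equiv.Perm W := g * f with hh
  set m : ℤ := (Function.minimalPeriod (h • · : W → W) x : ℤ) with hm
  have hinv : h⁻¹ = f * g := by
    rw [inv_eq_iff_mul_eq_one]
    ext y
    simp [hh, hf, hg]
  have per : ∀ i j : ℤ, (h ^ i) x = (h ^ j) x ↔ m ∣ i - j := by
    intro i j
    rw [hm, ← MulAction.zpow_smul_eq_iff_minimalPeriod_dvd, Equiv.Perm.smul_def, sub_eq_neg_add,
      zpow_add, Equiv.Perm.mul_apply, zpow_neg, Equiv.Perm.inv_eq_iff_eq]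
  have gconj : ∀ i : ℤ, g * h ^ i = h ^ (-i) * g := by
    intro i
    have hgg : g * g = 1 := by ext y; simp [hg]
    have e : g * h * g⁻¹ = h⁻¹ := by
      have : g⁻¹ = g := inv_eq_of_mul_eq_one_left hgg
      rw [this, hinv, hh, ← mul_assoc, hgg, one_mul]
    have e2 := conj_zpow (i := i) (a := g) (b := h)
    rw [e, inv_zpow', ] at e2
    rw [e2]; group
  have gi : ∀ i : ℤ, g ((h ^ i) x) = (h ^ (-i)) x := by
    intro i
    have := congrArg (fun p : Equiv.Perm W => p x) (gconj i)
    simpa [hx] using this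
  have fi : ∀ i : ℤ, f ((h ^ i) x) = (h ^ (-(i + 1))) x := by
    intro i
    have e : f ((h ^ i) x) = g (h ((h ^ i) x)) := by simp [hh, hg]
    rw [e, ← gi (i + 1), add_comm i 1, zpow_add, zpow_one]
    rfl
  have orb : ∀ z, Relation.EqvGen (fun a b => b = f a ∨ b = g a) x z ↔ ∃ i : ℤ, z = (h ^ i) x := by
    have step : ∀ a b, (b = f a ∨ b = g a) →
        ((∃ i : ℤ, a = (h ^ i) x) ↔ ∃ i : ℤ, b = (h ^ i) x) := by
      have fwd : ∀ a b, (b = f a ∨ b = g a) → (∃ i : ℤ, a = (h ^ i) x) →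
          ∃ i : ℤ, b = (h ^ i) x := by
        rintro a b (rfl | rfl) ⟨i, rfl⟩
        · exact ⟨_, fi i⟩
        · exact ⟨_, gi i⟩
      intro a b hab
      refine ⟨fwd a b hab, fwd b a ?_⟩
      rcases hab with rfl | rfl
      · exact Or.inl (hf a).symm
      · exact Or.inr (hg a).symm
    intro z
    constructor
    · intro hz
      have gen : ∀ a b, Relation.EqvGen (fun a b => b = f a ∨ b = g a) a b →
          ((∃ i : ℤ, a = (h ^ i) x) ↔ ∃ i : ℤ, b = (h ^ i) x) := by
        intro a b hab
        induction hab with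
        | rel a b hab => exact step a b hab
        | refl a => exact Iff.rfl
        | symm a b _ ih => exact ih.symm
        | trans a b c _ _ ih1 ih2 => exact ih1.trans ih2
      exact (gen x z hz).1 ⟨0, by simp⟩
    · rintro ⟨i, rfl⟩
      have hs : ∀ y, Relation.EqvGen (fun a b => b = f a ∨ b = g a) y (h y) := fun y =>
        .trans _ _ _ (.rel y (f y) (Or.inl rfl)) (.rel _ _ (Or.inr rfl))
      induction i using Int.induction_on with
      | zero => exact .refl _
      | succ i ih =>
        rw [add_comm, zpow_add, zpow_one]
        exact .trans _ _ _ ih (hs _)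
      | pred i ih =>
        refine .trans _ _ _ ih (.symm _ _ ?_)
        have := hs ((h ^ (-(i : ℤ) - 1)) x)
        rwa [← Equiv.Perm.mul_apply, ← zpow_one_add, add_sub_cancel] at this
  have fixf : ∀ i : ℤ, f ((h ^ i) x) = (h ^ i) x ↔ m ∣ 2 * i + 1 := by
    intro i
    rw [fi, per, ← dvd_neg]
    ring_nf
  have fixg : ∀ i : ℤ, g ((h ^ i) x) = (h ^ i) x ↔ m ∣ 2 * i := by
    intro i
    rw [gi, per, ← dvd_neg]
    ring_nf
  have base : ∀ i : ℤ, (h ^ i) x = x ↔ m ∣ i := by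
    intro i
    have := per i 0
    simpa using this
  have m1 : ¬ m ∣ 1 := by
    intro h1
    refine hfg x ⟨?_, hx⟩
    have := (fixf 0).2 (by simpa using h1)
    simpa using this
  have m0 : m ≠ 0 := by
    have : 0 < Function.minimalPeriod (h • · : W → W) x := by
      apply Function.minimalPeriod_pos_of_mem_periodicPts
      have hinj : Function.Injective (h • · : W → W) := MulAction.injective h
      exact hinj.mem_periodicPts x
    rw [hm]
    exact_mod_cast this.ne'
  obtain ⟨j, hj1, hj2⟩ : ∃ j : ℤ, ¬ m ∣ j ∧ (m ∣ 2 * j + 1 ∨ m ∣ 2 * j) := by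
    rcases Int.even_or_odd' m with ⟨q, hq | hq⟩
    · refine ⟨q, ?_, Or.inr (by rw [← hq])⟩
      rintro ⟨c, hc⟩
      rw [hq] at hc
      have hq0 : q ≠ 0 := by rintro rfl; exact m0 (by simpa using hq)
      have : q * (2 * c - 1) = 0 := by linear_combination -hc
      rcases mul_eq_zero.1 this with h0 | h0
      · exact hq0 h0
      · omega
    · refine ⟨q, ?_, Or.inl (by rw [← hq])⟩
      intro hd
      refine m1 ?_
      have := (dvd_sub (dvd_refl m) (hd.mul_left 2))
      rwa [hq, add_sub_cancel_left, ← hq] at this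
  have uniq : ∀ i : ℤ, ¬ m ∣ i → (m ∣ 2 * i + 1 ∨ m ∣ 2 * i) → m ∣ i - j := by
    have odd_of : ∀ i c : ℤ, ¬ m ∣ i → 2 * i = m * c → c % 2 = 1 := by
      intro i c hi hc
      by_contra hne
      have : c = 2 * (c / 2) := by omega
      refine hi ⟨c / 2, ?_⟩
      have h2 : 2 * i = 2 * (m * (c / 2)) := by rw [hc]; nth_rewrite 1 [this]; ring
      linarith
    have halve : ∀ i a b : ℤ, 2 * (i - j) = m * (a - b) → a % 2 = b % 2 → m ∣ i - j := by
      intro i a b h1 h2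
      have : a - b = 2 * ((a - b) / 2) := by omega
      refine ⟨(a - b) / 2, ?_⟩
      have h3 : 2 * (i - j) = 2 * (m * ((a - b) / 2)) := by
        rw [h1]; nth_rewrite 1 [this]; ring
      linarith
    have par1 : ∀ i c : ℤ, 2 * i + 1 = m * c → m % 2 = 1 ∧ c % 2 = 1 := by
      intro i c hc
      have ho : Odd (m * c) := ⟨i, hc.symm⟩
      rw [Int.odd_mul, Int.odd_iff, Int.odd_iff] at ho
      exact ho
    have par2 : ∀ i c : ℤ, c % 2 = 1 → 2 * i = m * c → m % 2 = 0 := by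
      intro i c hc he
      have hev : Even (m * c) := ⟨i, by rw [← he]; ring⟩
      rw [Int.even_mul, Int.even_iff, Int.even_iff] at hev
      omega
    intro i hi hi2
    rcases hi2 with ⟨a, ha⟩ | ⟨a, ha⟩ <;> rcases hj2 with ⟨b, hb⟩ | ⟨b, hb⟩
    · have h1 := par1 i a ha
      have h2 := par1 j b hb
      exact halve i a b (by linear_combination ha - hb) (by omega)
    · have h1 := par1 i a ha
      have h2 := par2 j b (odd_of j b hj1 hb) hb
      omega
    · have h1 := par2 i a (odd_of i a hi ha) ha
      have h2 := par1 j b hb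
      omega
    · have h1 := odd_of i a hi ha
      have h2 := odd_of j b hj1 hb
      exact halve i a b (by linear_combination ha - hb) (by omega)
  refine ⟨(h ^ j) x, fun he => hj1 ((base j).1 he), fun z => ?_⟩
  rw [orb]
  constructor
  · rintro ⟨⟨i, rfl⟩, hi⟩
    rw [fixf, fixg] at hi
    by_cases hmi : m ∣ i
    · exact Or.inl ((base i).2 hmi)
    · exact Or.inr ((per i j).2 (uniq i hmi hi))
  · rintro (rfl | rfl)
    · exact ⟨⟨0, by simp⟩, Or.inr hx⟩
    · refine ⟨⟨j, rfl⟩, ?_⟩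
      rw [fixf, fixg]
      exact hj2

/-- The involution of the vertices defined by a Brauer diagram. -/
theorem exists_partner {α : PartitionDiagram n} (h : α.IsBrauer) :
    ∃ f : Vertex n → Vertex n, (∀ a, f a ≠ a) ∧ (∀ a, f (f a) = a) ∧
      ∀ a b, α.rel a b ↔ b = a ∨ b = f a := by
  rw [isBrauer_iff] at h
  choose f h1 h2 using h
  refine ⟨f, h1, fun a => ?_, h2⟩
  have e1 : α.rel (f a) a := α.rel.symm' ((h2 a (f a)).2 (Or.inr rfl))
  rcases (h2 (f a) a).1 e1 with e | e
  · exact absurd e.symm (h1 a)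
  · exact e.symm

theorem mul_isBrauer {α β : PartitionDiagram n} (hα : α.IsBrauer) (hβ : β.IsBrauer) :
    (α * β).IsBrauer := by
  obtain ⟨f, f1, f2, f3⟩ := exists_partner hα
  obtain ⟨g, g1, g2, g3⟩ := exists_partner hβ
  let F0 : Vertex3 n → Vertex3 n := fun w => match w with
    | Sum.inl x => onTop (f (Sum.inl x))
    | Sum.inr (Sum.inl x) => onTop (f (Sum.inr x))
    | Sum.inr (Sum.inr x) => Sum.inr (Sum.inr x)
  let G0 : Vertex3 n → Vertex3 n := fun w => match w with
    | Sum.inl x => Sum.inl x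
    | Sum.inr (Sum.inl x) => onBottom (g (Sum.inl x))
    | Sum.inr (Sum.inr x) => onBottom (g (Sum.inr x))
  have tinj : Function.Injective (onTop : Vertex n → Vertex3 n) := by
    rintro (a | a) (b | b) h <;> simp_all [onTop]
  have binj : Function.Injective (onBottom : Vertex n → Vertex3 n) := by
    rintro (a | a) (b | b) h <;> simp_all [onBottom]
  have oinj : Function.Injective (outer : Vertex n → Vertex3 n) := by
    rintro (a | a) (b | b) h <;> simp_all [outer]
  have Ft : ∀ a, F0 (onTop a) = onTop (f a) := by rintro (a | a) <;> rfl
  have Gb : ∀ a, G0 (onBottom a) = onBottom (g a) := by rintro (a | a) <;> rfl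
  have F2 : ∀ w, F0 (F0 w) = w := by
    rintro (x | x | x)
    · exact (Ft (f (Sum.inl x))).trans (by rw [f2]; rfl)
    · exact (Ft (f (Sum.inr x))).trans (by rw [f2]; rfl)
    · rfl
  have G2 : ∀ w, G0 (G0 w) = w := by
    rintro (x | x | x)
    · rfl
    · exact (Gb (g (Sum.inl x))).trans (by rw [g2]; rfl)
    · exact (Gb (g (Sum.inr x))).trans (by rw [g2]; rfl)
  have Fup : ∀ x, F0 (Sum.inl x) ≠ Sum.inl x := fun x h => f1 (Sum.inl x) (tinj h)
  have Fmid : ∀ x, F0 (Sum.inr (Sum.inl x)) ≠ Sum.inr (Sum.inl x) :=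
    fun x h => f1 (Sum.inr x) (tinj h)
  have Gmid : ∀ x, G0 (Sum.inr (Sum.inl x)) ≠ Sum.inr (Sum.inl x) :=
    fun x h => g1 (Sum.inl x) (binj h)
  have Glow : ∀ x, G0 (Sum.inr (Sum.inr x)) ≠ Sum.inr (Sum.inr x) :=
    fun x h => g1 (Sum.inr x) (binj h)
  have fixed : ∀ w, (F0 w = w ∨ G0 w = w) ↔ ∃ a, outer a = w := by
    rintro (x | x | x)
    · exact ⟨fun _ => ⟨Sum.inl x, rfl⟩, fun _ => Or.inr rfl⟩
    · constructor
      · rintro (h | h)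
        · exact absurd h (Fmid x)
        · exact absurd h (Gmid x)
      · rintro ⟨a | a, h⟩ <;> simp [outer] at h
    · exact ⟨fun _ => ⟨Sum.inr x, rfl⟩, fun _ => Or.inl rfl⟩
  have nofix : ∀ w, ¬ (F0 w = w ∧ G0 w = w) := by
    rintro (x | x | x) ⟨h1, h2⟩
    · exact Fup x h1
    · exact Fmid x h1
    · exact Glow x h2
  have conn : ∀ w w', Relation.EqvGen (ProductEdge α β) w w' ↔
      Relation.EqvGen (fun a b => b = F0 a ∨ b = G0 a) w w' := by
    intro w w'
    constructor
    · intro h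
      induction h with
      | rel x y hxy =>
        cases hxy with
        | top a b h =>
          rcases (f3 a b).1 h with rfl | rfl
          · exact .refl _
          · exact .rel _ _ (Or.inl (Ft a).symm)
        | bottom a b h =>
          rcases (g3 a b).1 h with rfl | rfl
          · exact .refl _
          · exact .rel _ _ (Or.inr (Gb a).symm)
      | refl x => exact .refl _
      | symm x y _ ih => exact .symm _ _ ih
      | trans x y z _ _ ih1 ih2 => exact .trans _ _ _ ih1 ih2
    · intro h
      have et : ∀ a, Relation.EqvGen (ProductEdge α β) (onTop a) (onTop (f a)) := fun a =>
        .rel _ _ (.top _ _ ((f3 a (f a)).2 (Or.inr rfl)))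
      have eb : ∀ a, Relation.EqvGen (ProductEdge α β) (onBottom a) (onBottom (g a)) := fun a =>
        .rel _ _ (.bottom _ _ ((g3 a (g a)).2 (Or.inr rfl)))
      induction h with
      | rel x y hxy =>
        rcases hxy with rfl | rfl
        · rcases x with x | x | x
          · exact et (Sum.inl x)
          · exact et (Sum.inr x)
          · exact .refl _
        · rcases x with x | x | x
          · exact .refl _
          · exact eb (Sum.inl x)
          · exact eb (Sum.inr x)
      | refl x => exact .refl _
      | symm x y _ ih => exact .symm _ _ ih
      | trans x y z _ _ ih1 ih2 => exact .trans _ _ _ ih1 ih2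
  let F : Equiv.Perm (Vertex3 n) := ⟨F0, F0, F2, F2⟩
  let G : Equiv.Perm (Vertex3 n) := ⟨G0, G0, G2, G2⟩
  rw [isBrauer_iff]
  intro a
  have key : ∃ y, y ≠ outer a ∧ ∀ z,
      (Relation.EqvGen (fun a b => b = F0 a ∨ b = G0 a) (outer a) z ∧ (F0 z = z ∨ G0 z = z))
        ↔ z = outer a ∨ z = y := by
    rcases a with x | x
    · exact orbit_fixed F G F2 G2 nofix (Sum.inl x) rfl
    · obtain ⟨y, hy1, hy2⟩ := orbit_fixed G F G2 F2 (fun w h => nofix w h.symm)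
        (Sum.inr (Sum.inr x)) rfl
      refine ⟨y, hy1, fun z => ?_⟩
      refine Iff.trans ?_ (hy2 z)
      have e : (fun a b => b = G a ∨ b = F a) = fun a b => b = F0 a ∨ b = G0 a := by
        funext a b
        exact propext or_comm
      rw [e]
      exact and_congr Iff.rfl or_comm
  obtain ⟨y, hy1, hy2⟩ := key
  obtain ⟨b, rfl⟩ := (fixed y).1 ((hy2 y).2 (Or.inr rfl)).2
  refine ⟨b, fun h => hy1 (congrArg outer h), fun c => ?_⟩
  rw [mul_rel, conn]
  have h1 := hy2 (outer c)
  rw [oinj.eq_iff, oinj.eq_iff] at h1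
  rw [← h1]
  exact ⟨fun h => ⟨h, (fixed _).2 ⟨c, rfl⟩⟩, fun h => h.1⟩

end Closure

/-- The Brauer monoid `B_n`, as a submonoid of the partition monoid. -/
def brauerMonoid (n : ℕ) : Submonoid (PartitionDiagram n) where
  carrier := {α | α.IsBrauer}
  one_mem' := one_isBrauer
  mul_mem' := mul_isBrauer

/-- The Brauer monoid `B_n`, as a type. -/
abbrev Brauer (n : ℕ) : Type := brauerMonoid n

namespace Brauer

variable {n : ℕ}

/-- `D_r`: the Brauer diagrams of rank `r`. -/
def D (n r : ℕ) : Set (Brauer n) := {α | α.1.rank = r}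

/-- `P_r`: the projections of rank `r`. -/
def P (n r : ℕ) : Set (Brauer n) :=
  {ε | ε * ε = ε ∧ ε.1.flip = ε.1 ∧ ε.1.rank = r}

/-- `p_r = |P_r|`. -/
noncomputable def p (n r : ℕ) : ℕ := (P n r).ncard

/-- The number of the `κ`-class of a vertex. Counting vertices from `0`, the classes are
`{0}, {1,2}, {3,4}, …` for odd `n`, and `{0,1}, {2,3}, …` for even `n`. -/
def label (n : ℕ) (x : Fin n) : ℕ := if Odd n then (x.1 + 1) / 2 else x.1 / 2

/-- The diagram `ζ`: upper and lower kernel are both `κ`; for odd `n` the first upper vertex is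
joined to the first lower vertex, and this is the only transversal; for even `n` there is none. -/
def zetaDiagram (n : ℕ) : PartitionDiagram n where
  rel := Setoid.ker (fun v : Vertex n => match v with
    | Sum.inl x => (label n x, decide (Odd n ∧ label n x = 0))
    | Sum.inr x => (label n x, true))

theorem label_cases (x : Fin n) :
    ((Odd n ∧ label n x = 0) ∧ ∀ z, label n x = label n z ↔ z = x) ∨
    (¬ (Odd n ∧ label n x = 0) ∧ ∃ y, y ≠ x ∧ ∀ z, label n x = label n z ↔ z = x ∨ z = y) := by
  have hx := x.2
  by_cases hn : Odd n
  · have lab : ∀ z : Fin n, label n z = (z.1 + 1) / 2 := fun z => if_pos hn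
    have hn2 := Nat.odd_iff.1 hn
    simp only [lab, hn, true_and]
    by_cases h0 : x.1 = 0
    · left
      refine ⟨by omega, fun z => ?_⟩
      rw [Fin.ext_iff]
      omega
    · right
      refine ⟨by omega, ?_⟩
      by_cases h1 : x.1 % 2 = 1
      · refine ⟨⟨x.1 + 1, by omega⟩, by simp [Fin.ext_iff], fun z => ?_⟩
        simp only [Fin.ext_iff]
        omega
      · refine ⟨⟨x.1 - 1, by omega⟩, by simp only [Ne, Fin.ext_iff]; omega, fun z => ?_⟩
        simp only [Fin.ext_iff]
        omega
  · have lab : ∀ z : Fin n, label n z = z.1 / 2 := fun z => if_neg hn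
    have hn2 : n % 2 = 0 := Nat.even_iff.1 (Nat.not_odd_iff_even.1 hn)
    simp only [lab, hn, false_and]
    right
    refine ⟨not_false, ?_⟩
    by_cases h1 : x.1 % 2 = 0
    · refine ⟨⟨x.1 + 1, by omega⟩, by simp [Fin.ext_iff], fun z => ?_⟩
      simp only [Fin.ext_iff]
      omega
    · refine ⟨⟨x.1 - 1, by omega⟩, by simp only [Ne, Fin.ext_iff]; omega, fun z => ?_⟩
      simp only [Fin.ext_iff]
      omega

theorem zetaDiagram_isBrauer (n : ℕ) : (zetaDiagram n).IsBrauer := by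
  rw [isBrauer_iff]
  have r1 : ∀ x z : Fin n, (zetaDiagram n).rel (Sum.inl x) (Sum.inl z) ↔ label n x = label n z := by
    intro x z
    refine Prod.ext_iff.trans ⟨fun h => h.1, fun h => ⟨h, ?_⟩⟩
    change decide (Odd n ∧ label n x = 0) = decide (Odd n ∧ label n z = 0)
    rw [h]
  have r2 : ∀ x z : Fin n, (zetaDiagram n).rel (Sum.inr x) (Sum.inr z) ↔ label n x = label n z := by
    intro x z
    exact Prod.ext_iff.trans ⟨fun h => h.1, fun h => ⟨h, rfl⟩⟩
  have r3 : ∀ x z : Fin n, (zetaDiagram n).rel (Sum.inl x) (Sum.inr z) ↔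
      label n x = label n z ∧ Odd n ∧ label n x = 0 := by
    intro x z
    refine Prod.ext_iff.trans (and_congr Iff.rfl ?_)
    exact decide_eq_true_iff
  have r4 : ∀ x z : Fin n, (zetaDiagram n).rel (Sum.inr x) (Sum.inl z) ↔
      label n x = label n z ∧ Odd n ∧ label n x = 0 := by
    intro x z
    rw [(zetaDiagram n).rel.comm', r3]
    constructor <;> rintro ⟨h1, h2⟩ <;> rw [h1] at * <;> exact ⟨rfl, h2⟩
  rintro (x | x) <;> rcases label_cases x with ⟨h1, h2⟩ | ⟨h1, y, h2, h3⟩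
  · refine ⟨Sum.inr x, by simp, ?_⟩
    rintro (z | z)
    · simp [r1, h2]
    · simp [r3, ← h2, h1.1, h1.2]
  · refine ⟨Sum.inl y, by simpa using h2, ?_⟩
    rintro (z | z)
    · simp [r1, h3]
    · simp [r3, h1]
  · refine ⟨Sum.inl x, by simp, ?_⟩
    rintro (z | z)
    · simp [r4, ← h2, h1.1, h1.2]
    · simp [r2, h2]
  · refine ⟨Sum.inr y, by simpa using h2, ?_⟩
    rintro (z | z)
    · simp [r4, h1]
    · simp [r2, h3]

/-- `ζ` as an element of the Brauer monoid. -/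
def zeta (n : ℕ) : Brauer n := ⟨zetaDiagram n, zetaDiagram_isBrauer n⟩

/-- `U = T ∩ S_n`, where `T` belongs to the `R`-class of `ζ`, and `S_n` is the group of units. -/
def U (n : ℕ) : Submonoid (Brauer n) := setT (zeta n) ⊓ IsUnit.submonoid (Brauer n)

/-- The right congruence `σ = R_I ∨ L^U`, where `I` belongs to the `R`-class of `ζ`. -/
def sigma (n : ℕ) : RightCongruence (Brauer n) :=
  RightCongruence.join (RightCongruence.rees (setI (zeta n)) (setI_mul_mem (zeta n)))
    (relativeL (U n))

/-- `Ω`: the classes of `σ` that meet `D_1 ∪ D_3`. -/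
def Omega (n : ℕ) : Set (sigma n).Classes := {ω | ∃ α ∈ D n 1 ∪ D n 3, ω = (sigma n).cls α}

end Brauer

end DiagramMonoid

/-! Everything is read off from blocks. Since `α * (star α * α) = α`, the `R`-order is reverse
inclusion of upper hooks (`leR_iff`). Hence `K` consists of the diagrams whose upper hooks are all
`κ`-classes, and in each of them the first upper vertex starts a transversal. Because `U` lies in
`T`, left multiplication by `U` preserves both `K` and `I`. So `σ` collapses `I` to a point and is
`L^U` on `K` (`join_rees_relativeL_imp`).

Generation: let `core` be the rank `3` projection obtained from `ζ` by opening the hook `{1,2}`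
(vertices counted from `0`). An element of `K` of rank `1` or `3` leaves at most one `κ`-class
unhooked. A permutation in `U` moves that class to `{1,2}`, which puts the element into `core * B_n`
without changing its `σ`-class; the class of `I` is reached as well (`exists_sigma_rel_core_mul`).

Faithfulness: suppose `β` and `γ` act alike on all classes of `core * s`. Related products lie in
`K` together, and in that case have the same lower hooks, as left multiplication does not destroy
these. Different upper hooks of `β` and `γ` would be seen by a product lying in `I` for only one of
them (`exists_separating`). Once the upper hooks agree, a product of rank `1` in `K` has a single
lower vertex outside its hooks, and this reveals the transversals; the lower hooks follow
(`eq_of_forall_core_mul`).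

Counting: an element of `K` of rank `1` is determined by `star α * α`. In rank `3` its `σ`-class is
determined by `star α * α` together with the lower end of the transversal at the first vertex, for
which there are three choices (`exists_mem_U_eq_mul`). With the class of `I` this gives `1 + 3 p_3 +
p_1`. The degree bound follows because a cyclic action of a monoid, with trivially acting identity,
is a right congruence action (`RightAction.Monogenic.isRightCongruenceAction`). -/

namespace DiagramMonoid

open PartitionDiagram

namespace Brauer

variable {n : ℕ}

/-- Two upper vertices lie in the same block. -/
def UU (α : Brauer n) (x y : Fin n) : Prop := α.1.rel (Sum.inl x) (Sum.inl y)

/-- An upper vertex and a lower vertex lie in the same block. -/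
def UL (α : Brauer n) (x y : Fin n) : Prop := α.1.rel (Sum.inl x) (Sum.inr y)

/-- Two lower vertices lie in the same block. -/
def LL (α : Brauer n) (x y : Fin n) : Prop := α.1.rel (Sum.inr x) (Sum.inr y)

/-! ### Blocks of a Brauer diagram: hooks and transversals. -/

section Blocks

variable {α β : Brauer n} {x y z : Fin n}

theorem rel_unique {a b c : Vertex n} (hab : α.1.rel a b) (hac : α.1.rel a c) (hb : b ≠ a)
    (hc : c ≠ a) : b = c := by
  obtain ⟨f, -, -, h⟩ := exists_partner α.2
  exact (((h a b).1 hab).resolve_left hb).trans (((h a c).1 hac).resolve_left hc).symm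

theorem exists_rel_ne (α : Brauer n) (a : Vertex n) : ∃ b, b ≠ a ∧ α.1.rel a b := by
  obtain ⟨f, h1, -, h⟩ := exists_partner α.2
  exact ⟨f a, h1 a, (h a _).2 (Or.inr rfl)⟩

theorem UU.refl (α : Brauer n) (x : Fin n) : UU α x x := α.1.rel.refl' _

theorem LL.refl (α : Brauer n) (x : Fin n) : LL α x x := α.1.rel.refl' _

theorem UU.symm (h : UU α x y) : UU α y x := α.1.rel.symm' h

theorem LL.symm (h : LL α x y) : LL α y x := α.1.rel.symm' h

theorem UU.unique (h : UU α x y) (h' : UU α x z) (hy : y ≠ x) (hz : z ≠ x) : y = z :=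
  Sum.inl_injective (rel_unique h h' (by simpa using hy) (by simpa using hz))

theorem LL.unique (h : LL α x y) (h' : LL α x z) (hy : y ≠ x) (hz : z ≠ x) : y = z :=
  Sum.inr_injective (rel_unique h h' (by simpa using hy) (by simpa using hz))

theorem UL.eq_of_uu (h : UL α x y) (h' : UU α x z) : z = x := by
  by_contra hz
  exact absurd (rel_unique h h' (by simp) (by simpa using hz)) (by simp)

theorem UL.eq_of_ll (h : UL α x y) (h' : LL α y z) : z = y := by
  by_contra hz
  exact absurd (rel_unique (α.1.rel.symm' h) h' (by simp) (by simpa using hz)) (by simp)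

theorem UL.unique_lower (h : UL α x y) (h' : UL α x z) : y = z :=
  Sum.inr_injective (rel_unique h h' (by simp) (by simp))

theorem UL.unique_upper (h : UL α x z) (h' : UL α y z) : x = y :=
  Sum.inl_injective (rel_unique (α.1.rel.symm' h) (α.1.rel.symm' h') (by simp) (by simp))

theorem upper_cases (α : Brauer n) (x : Fin n) :
    (∃ y, y ≠ x ∧ UU α x y) ∨ ∃ y, UL α x y := by
  obtain ⟨b | b, h1, h2⟩ := exists_rel_ne α (Sum.inl x)
  · exact Or.inl ⟨b, by simpa using h1, h2⟩
  · exact Or.inr ⟨b, h2⟩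

theorem lower_cases (α : Brauer n) (x : Fin n) :
    (∃ y, y ≠ x ∧ LL α x y) ∨ ∃ y, UL α y x := by
  obtain ⟨b | b, h1, h2⟩ := exists_rel_ne α (Sum.inr x)
  · exact Or.inr ⟨b, α.1.rel.symm' h2⟩
  · exact Or.inl ⟨b, by simpa using h1, h2⟩

/-- Since all blocks have the same size, an inclusion of Brauer diagrams is an equality. -/
theorem eq_of_rel_imp (huu : ∀ x y, UU α x y → UU β x y) (hul : ∀ x y, UL α x y → UL β x y)
    (hll : ∀ x y, LL α x y → LL β x y) : α = β := by
  have key : ∀ a b, α.1.rel a b → β.1.rel a b := by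
    rintro (a | a) (b | b) h
    · exact huu a b h
    · exact hul a b h
    · exact β.1.rel.symm' (hul b a (α.1.rel.symm' h))
    · exact hll a b h
  refine Subtype.ext (PartitionDiagram.ext (Setoid.ext fun a b => ⟨key a b, fun h => ?_⟩))
  by_cases hab : b = a
  · rw [hab]
  · obtain ⟨c, hc, hac⟩ := exists_rel_ne α a
    rwa [rel_unique h (key a c hac) hab hc]

end Blocks

/-! ### Paths in the product graph. -/

section Products

variable {α β : Brauer n} {x y z p q r : Fin n}

theorem conn_top {a b : Vertex n} (h : α.1.rel a b) :
    Relation.EqvGen (ProductEdge α.1 β.1) (onTop a) (onTop b) :=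
  .rel _ _ (.top a b h)

theorem conn_bottom {a b : Vertex n} (h : β.1.rel a b) :
    Relation.EqvGen (ProductEdge α.1 β.1) (onBottom a) (onBottom b) :=
  .rel _ _ (.bottom a b h)

theorem UU.mul_right (h : UU α x y) (β : Brauer n) : UU (α * β) x y :=
  conn_top (a := Sum.inl x) (b := Sum.inl y) h

theorem LL.mul_left (h : LL β x y) (α : Brauer n) : LL (α * β) x y :=
  conn_bottom (a := Sum.inr x) (b := Sum.inr y) h

theorem UL.mul (h : UL α x y) (h' : UL β y z) : UL (α * β) x z :=
  .trans _ _ _ (conn_top (a := Sum.inl x) (b := Sum.inr y) h)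
    (conn_bottom (a := Sum.inl y) (b := Sum.inr z) h')

theorem UU.mul_of_ul (h : UU β p q) (hx : UL α x p) (hy : UL α y q) : UU (α * β) x y :=
  .trans _ _ _ (conn_top (a := Sum.inl x) (b := Sum.inr p) hx)
    (.trans _ _ _ (conn_bottom (a := Sum.inl p) (b := Sum.inl q) h)
      (.symm _ _ (conn_top (a := Sum.inl y) (b := Sum.inr q) hy)))

theorem LL.mul_of_ul (h : LL α p q) (hx : UL β p x) (hy : UL β q y) : LL (α * β) x y :=
  .trans _ _ _ (.symm _ _ (conn_bottom (a := Sum.inl p) (b := Sum.inr x) hx))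
    (.trans _ _ _ (conn_top (a := Sum.inr p) (b := Sum.inr q) h)
      (conn_bottom (a := Sum.inl q) (b := Sum.inr y) hy))

/-- The one longer path that is needed: down `α`, along an upper hook of `β`, back along a lower
hook of `α`, and down `β`. -/
theorem UL.mul_zigzag (h1 : UL α x p) (h2 : UU β p q) (h3 : LL α q r) (h4 : UL β r z) :
    UL (α * β) x z :=
  .trans _ _ _ (conn_top (a := Sum.inl x) (b := Sum.inr p) h1)
    (.trans _ _ _ (conn_bottom (a := Sum.inl p) (b := Sum.inl q) h2)
      (.trans _ _ _ (conn_top (a := Sum.inr q) (b := Sum.inr r) h3)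
        (conn_bottom (a := Sum.inl r) (b := Sum.inr z) h4)))

end Products

/-! ### Permutations, reflections and diagrams with prescribed hooks. -/

section Constructions

/-- The diagram whose blocks are the orbits of a fixed-point-free involution. -/
def ofInvolution (f : Vertex n → Vertex n) (h1 : ∀ a, f a ≠ a) (h2 : ∀ a, f (f a) = a) :
    Brauer n :=
  ⟨⟨{ r := fun a b => b = a ∨ b = f a
      iseqv :=
        { refl := fun _ => Or.inl rfl
          symm := by
            rintro a b (rfl | rfl)
            · exact Or.inl rfl
            · exact Or.inr (h2 a).symm
          trans := by
            rintro a b c (rfl | rfl) (rfl | rfl)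
            · exact Or.inl rfl
            · exact Or.inr rfl
            · exact Or.inr rfl
            · exact Or.inl (h2 a) } }⟩,
    (isBrauer_iff _).2 fun a => ⟨f a, h1 a, fun _ => Iff.rfl⟩⟩

/-- The unit of the Brauer monoid given by a permutation. -/
def ofPerm (π : Equiv.Perm (Fin n)) : Brauer n :=
  ofInvolution (Sum.elim (fun x => Sum.inr (π x)) (fun y => Sum.inl (π.symm y)))
    (by rintro (a | a) <;> simp) (by rintro (a | a) <;> simp)

theorem ul_ofPerm (π : Equiv.Perm (Fin n)) (x : Fin n) : UL (ofPerm π) x (π x) :=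
  Or.inr rfl

/-- The reflection of a Brauer diagram. -/
def star (α : Brauer n) : Brauer n :=
  ⟨α.1.flip, by
    obtain ⟨f, h1, -, h⟩ := exists_partner α.2
    refine (isBrauer_iff _).2 fun a => ⟨(f a.swap).swap, fun e => h1 a.swap ?_, fun c => ?_⟩
    · simpa using congrArg Sum.swap e
    · change α.1.rel a.swap c.swap ↔ _
      rw [h]
      constructor
      · rintro (e | e)
        · exact Or.inl (Sum.swap_leftInverse.injective e)
        · exact Or.inr (by rw [← e, Sum.swap_swap])
      · rintro (rfl | rfl)
        · exact Or.inl rfl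
        · exact Or.inr (Sum.swap_swap _)⟩

theorem uu_star {α : Brauer n} {x y : Fin n} : UU (star α) x y ↔ LL α x y := Iff.rfl

theorem ll_star {α : Brauer n} {x y : Fin n} : LL (star α) x y ↔ UU α x y := Iff.rfl

theorem ul_star {α : Brauer n} {x y : Fin n} : UL (star α) x y ↔ UL α y x :=
  ⟨fun h => α.1.rel.symm' h, fun h => α.1.rel.symm' h⟩

/-- The diagram that is symmetric in the horizontal axis, whose hooks are given by the nontrivial
orbits of an involution, and whose transversals are given by the fixed points. -/
def ofHooks (k : Fin n → Fin n) (hk : ∀ x, k (k x) = x) : Brauer n :=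
  ofInvolution
    (Sum.elim (fun x => if k x = x then Sum.inr x else Sum.inl (k x))
      (fun x => if k x = x then Sum.inl x else Sum.inr (k x)))
    (by rintro (a | a) <;> simp only [Sum.elim_inl, Sum.elim_inr] <;> split_ifs with h <;> simp [h])
    (by
      rintro (a | a) <;> simp only [Sum.elim_inl, Sum.elim_inr] <;> split_ifs with h
      · simp [h]
      · simp [hk, Ne.symm h]
      · simp [h]
      · simp [hk, Ne.symm h])

variable {k : Fin n → Fin n} {hk : ∀ x, k (k x) = x} {x y : Fin n}

theorem uu_ofHooks : UU (ofHooks k hk) x y ↔ y = x ∨ y = k x := by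
  change (Sum.inl y = Sum.inl x ∨ Sum.inl y = ite _ _ _) ↔ _
  split_ifs with h <;> simp [h]

theorem ll_ofHooks : LL (ofHooks k hk) x y ↔ y = x ∨ y = k x := by
  change (Sum.inr y = Sum.inr x ∨ Sum.inr y = ite _ _ _) ↔ _
  split_ifs with h <;> simp [h]

theorem ul_ofHooks : UL (ofHooks k hk) x y ↔ y = x ∧ k x = x := by
  change (Sum.inr y = Sum.inl x ∨ Sum.inr y = ite _ _ _) ↔ _
  split_ifs with h <;> simp [h]

end Constructions

/-! ### The `R`-order in terms of upper hooks. -/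

section Green

variable {α β : Brauer n}

/-- The diagram `β * star β` has the upper hooks of `β`, which `α` has too, and is vertical at the
other upper vertices. Multiplying `α` by it on the left therefore changes nothing. Only one
inclusion of blocks has to be checked, by `eq_of_rel_imp`. -/
theorem mul_star_mul_of_uu (h : ∀ x y, UU β x y → UU α x y) : β * (star β * α) = α := by
  symm
  refine eq_of_rel_imp ?_ ?_ ?_
  · intro x y hxy
    by_cases hne : y = x
    · rw [hne]; exact UU.refl _ _
    by_cases hb : UU β x y
    · exact hb.mul_right _
    obtain ⟨z, hz, hxz⟩ | ⟨p, hp⟩ := upper_cases β x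
    · exact absurd (hxy.unique (h _ _ hxz) hne hz ▸ hxz) hb
    obtain ⟨z, hz, hyz⟩ | ⟨q, hq⟩ := upper_cases β y
    · exact absurd (hxy.symm.unique (h _ _ hyz) (Ne.symm hne) hz ▸ hyz.symm) hb
    exact UU.mul_of_ul (hxy.mul_of_ul (ul_star.2 hp) (ul_star.2 hq)) hp hq
  · intro x y hxy
    obtain ⟨z, hz, hxz⟩ | ⟨p, hp⟩ := upper_cases β x
    · exact absurd (hxy.eq_of_uu (h _ _ hxz)) hz
    · exact hp.mul ((ul_star.2 hp).mul hxy)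
  · intro x y hxy
    exact (hxy.mul_left _).mul_left _

theorem mul_star_mul_self (α : Brauer n) : α * (star α * α) = α :=
  mul_star_mul_of_uu fun _ _ h => h

/-- The `R`-order is the reverse inclusion of upper hooks. -/
theorem leR_iff : LeR α β ↔ ∀ x y, UU β x y → UU α x y := by
  constructor
  · rintro ⟨s, rfl⟩ x y h
    exact h.mul_right s
  · exact fun h => ⟨_, (mul_star_mul_of_uu h).symm⟩

theorem mem_rClass : α ∈ RClass β ↔ ∀ x y, UU α x y ↔ UU β x y := by
  change LeR α β ∧ LeR β α ↔ _
  rw [leR_iff, leR_iff]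
  exact ⟨fun h x y => ⟨h.2 x y, h.1 x y⟩, fun h => ⟨fun x y => (h x y).2, fun x y => (h x y).1⟩⟩

theorem mem_setK : α ∈ setK β ↔ ∀ x y, UU α x y → UU β x y := leR_iff

end Green

/-! ### Rank, its parity, and the projection `star α * α`. -/

section Rank

instance : Finite (PartitionDiagram n) := by
  refine Finite.of_injective (fun α : PartitionDiagram n => fun a b => α.rel a b) fun α β h => ?_
  ext a b
  exact iff_of_eq (congrFun (congrFun h a) b)

/-- A transversal has size two, so it contains exactly one upper vertex. -/
theorem rank_eq_upper (α : Brauer n) : α.1.rank = {x | ∃ y, UL α x y}.ncard := by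
  have himage : {B ∈ α.1.rel.classes | (∃ x, Sum.inl x ∈ B) ∧ ∃ y, Sum.inr y ∈ B} =
      (fun x : Fin n => {v | α.1.rel v (Sum.inl x)}) '' {x | ∃ y, UL α x y} := by
    ext B
    constructor
    · rintro ⟨⟨a, rfl⟩, ⟨x, hx⟩, ⟨y, hy⟩⟩
      have hx : α.1.rel (Sum.inl x) a := hx
      have hy : α.1.rel (Sum.inr y) a := hy
      refine ⟨x, ⟨y, α.1.rel.trans' hx (α.1.rel.symm' hy)⟩, ?_⟩
      ext v
      exact ⟨fun h => α.1.rel.trans' h hx, fun h => α.1.rel.trans' h (α.1.rel.symm' hx)⟩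
    · rintro ⟨x, ⟨y, hxy⟩, rfl⟩
      exact ⟨⟨_, rfl⟩, ⟨x, α.1.rel.refl' _⟩, ⟨y, α.1.rel.symm' hxy⟩⟩
  rw [PartitionDiagram.rank, himage]
  refine Set.InjOn.ncard_image ?_
  rintro x ⟨z, hx⟩ y - h
  have h' : α.1.rel (Sum.inl x) (Sum.inl y) :=
    (Set.ext_iff.1 h (Sum.inl x)).1 (α.1.rel.refl' (Sum.inl x))
  exact (hx.eq_of_uu h').symm

theorem rank_eq_lower (α : Brauer n) : α.1.rank = {y | ∃ x, UL α x y}.ncard := by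
  rw [rank_eq_upper]
  choose! f hf using fun x (h : ∃ y, UL α x y) => h
  refine Set.ncard_congr (fun x _ => f x) (fun x hx => ⟨x, hf x hx⟩) ?_ ?_
  · intro x y hx hy h
    exact (hf x hx).unique_upper (h ▸ hf y hy)
  · rintro y ⟨x, hx⟩
    exact ⟨x, ⟨y, hx⟩, (hf x ⟨y, hx⟩).unique_lower hx⟩

/-- Upper hooks of `α` survive in `α * β`, so a transversal of the product can only start where one
of `α` does. -/
theorem rank_mul_le (α β : Brauer n) : (α * β).1.rank ≤ α.1.rank := by
  rw [rank_eq_upper, rank_eq_upper]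
  refine Set.ncard_le_ncard ?_ (Set.toFinite _)
  rintro x ⟨y, hy⟩
  obtain ⟨z, hz, hxz⟩ | h := upper_cases α x
  · exact absurd (hy.eq_of_uu (hxz.mul_right β)) hz
  · exact h

/-- Encoding the upper hooks as an involution makes fixed-point counting available; applied to `ζ`
it also yields `kappa`. -/
theorem exists_hook (α : Brauer n) : ∃ k : Fin n → Fin n, (∀ x, k (k x) = x) ∧
    (∀ x y, UU α x y ↔ y = x ∨ y = k x) ∧ ∀ x, k x = x ↔ ∃ y, UL α x y := by
  have h : ∀ x, ∃ y, UU α x y ∧ (y = x ↔ ∃ z, UL α x z) := by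
    intro x
    obtain ⟨y, hy, hxy⟩ | h := upper_cases α x
    · exact ⟨y, hxy, fun h => absurd h hy, fun ⟨z, hz⟩ => hz.eq_of_uu hxy⟩
    · exact ⟨x, UU.refl _ _, fun _ => h, fun _ => rfl⟩
  choose k h1 h2 using h
  refine ⟨k, fun x => ?_, fun x y => ⟨fun hxy => ?_, ?_⟩, h2⟩
  · by_cases hx : k x = x
    · rw [hx, hx]
    · have hkx : k (k x) ≠ k x := by
        intro e
        obtain ⟨z, hz⟩ := (h2 (k x)).1 e
        exact hx (hz.eq_of_uu (h1 x).symm).symm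
      exact (h1 (k x)).unique (h1 x).symm hkx (Ne.symm hx)
  · by_cases hx : k x = x
    · obtain ⟨z, hz⟩ := (h2 x).1 hx
      exact Or.inl (hz.eq_of_uu hxy)
    · by_cases hy : y = x
      · exact Or.inl hy
      · exact Or.inr (hxy.unique (h1 x) hy hx)
  · rintro (rfl | rfl)
    · exact UU.refl _ _
    · exact h1 x

/-- The rank is the number of fixed points of an involution of the `n` upper vertices. -/
theorem rank_modEq (α : Brauer n) : n ≡ α.1.rank [MOD 2] := by
  obtain ⟨k, hk, -, hfix⟩ := exists_hook α
  have key := Equiv.Perm.card_fixedPoints_modEq (f := k) (p := 2) (n := 1)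
    (by funext x; exact hk x)
  rw [Fintype.card_fin] at key
  have e : {x | ∃ y, UL α x y} = Function.fixedPoints k := by
    ext x
    exact (hfix x).symm
  rwa [rank_eq_upper, e, Set.ncard_eq_toFinset_card', Set.toFinset_card]

theorem rank_star_mul (α : Brauer n) : (star α * α).1.rank = α.1.rank := by
  rw [rank_eq_upper, rank_eq_lower α]
  congr 1
  ext y
  constructor
  · rintro ⟨z, hz⟩
    obtain ⟨w, hw, hyw⟩ | h := lower_cases α y
    · exact absurd (hz.eq_of_uu (UU.mul_right (uu_star.2 hyw) α)) hw
    · exact h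
  · rintro ⟨x, hx⟩
    exact ⟨y, (ul_star.2 hx).mul hx⟩

/-- Idempotency comes from `α * (star α * α) = α`. For symmetry, a lower hook of `α` appears in both
rows of `star α * α`, while the lower end of a transversal gives a vertical block. -/
theorem star_mul_mem_P (α : Brauer n) : star α * α ∈ P n α.1.rank := by
  refine ⟨?_, ?_, rank_star_mul α⟩
  · rw [mul_assoc, mul_star_mul_self]
  · have : star (star α * α) = star α * α := by
      symm
      refine eq_of_rel_imp (fun x y h => ?_) (fun x y h => ?_) (fun x y h => ?_) <;>
        obtain ⟨z, hz, hxz⟩ | ⟨z, hz⟩ := lower_cases α x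
      · by_cases hy : y = x
        · rw [hy]; exact UU.refl _ _
        · rw [h.unique (UU.mul_right (uu_star.2 hxz) α) hy hz]
          exact uu_star.2 (hxz.mul_left _)
      · rw [((ul_star.2 hz).mul hz).eq_of_uu h]
        exact UU.refl _ _
      · exact absurd (h.eq_of_uu (UU.mul_right (uu_star.2 hxz) α)) hz
      · rw [h.unique_lower ((ul_star.2 hz).mul hz)]
        exact ul_star.2 ((ul_star.2 hz).mul hz)
      · by_cases hy : y = x
        · rw [hy]; exact LL.refl _ _
        · rw [h.unique (hxz.mul_left _) hy hz]
          exact ll_star.2 (UU.mul_right (uu_star.2 hxz) α)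
      · rw [((ul_star.2 hz).mul hz).eq_of_ll h]
        exact LL.refl _ _
    exact congrArg Subtype.val this

end Rank

end Brauer

end DiagramMonoid

namespace DiagramMonoid

open PartitionDiagram

/-! ### Cyclic actions and the two degrees. -/

section Actions

variable {S : Type*} [Semigroup S]

/-- Transport of an action along a bijection. -/
def RightAction.transport {X Y : Type*} (μ : RightAction S X) (e : X ≃ Y) : RightAction S Y where
  act y a := e (μ.act (e.symm y) a)
  act_act y a b := by simp [μ.act_act]

theorem RightAction.Faithful.transport {X Y : Type*} {μ : RightAction S X} (h : μ.Faithful)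
    (e : X ≃ Y) : (μ.transport e).Faithful := fun a b hab =>
  h a b fun x => e.injective (by simpa [RightAction.transport] using hab (e x))

theorem RightAction.Monogenic.transport {X Y : Type*} {μ : RightAction S X} (h : μ.Monogenic)
    (e : X ≃ Y) : (μ.transport e).Monogenic := by
  obtain ⟨x, hx⟩ := h
  refine ⟨e x, Set.eq_univ_of_forall fun y => ?_⟩
  obtain h | ⟨_, rfl, a, ha⟩ := hx.symm ▸ Set.mem_univ (e.symm y)
  · exact Or.inl (by rw [← (h : e.symm y = x)]; simp)
  · refine Or.inr ⟨_, rfl, a, ?_⟩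
    simp [RightAction.transport, ← ha]

/-- A faithful monogenic action of a monoid is a right congruence action: the generator may be
taken to be the image of the identity. -/
theorem RightAction.Monogenic.isRightCongruenceAction {M X : Type*} [Monoid M]
    {μ : RightAction M X} (h : μ.Monogenic) (h1 : ∀ x, μ.act x 1 = x) :
    μ.IsRightCongruenceAction := by
  obtain ⟨x, hx⟩ := h
  have hsurj : ∀ y, ∃ a, y = μ.act x a := by
    intro y
    obtain h | ⟨_, rfl, a, ha⟩ := hx.symm ▸ Set.mem_univ y
    · exact ⟨1, by rw [h1]; exact h⟩
    · exact ⟨a, ha⟩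
  -- The kernel of the orbit map `a ↦ x · a` of the generator.
  let σ : RightCongruence M :=
    ⟨Setoid.ker (μ.act x), fun a b s (hab : μ.act x a = μ.act x b) => by
      change μ.act x (a * s) = μ.act x (b * s)
      rw [← μ.act_act, ← μ.act_act, hab]⟩
  let e : σ.Classes ≃ X := Equiv.ofBijective (Quotient.lift (μ.act x) fun _ _ h => h)
    ⟨by
      rintro ⟨a⟩ ⟨b⟩ h
      exact Quotient.sound h, fun y => (hsurj y).elim fun a ha => ⟨Quotient.mk _ a, ha.symm⟩⟩
  refine ⟨σ, e.symm, fun y a => ?_⟩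
  obtain ⟨b, rfl⟩ := hsurj y
  rw [Equiv.symm_apply_eq]
  have hb : e.symm (μ.act x b) = Quotient.mk _ b := by
    rw [Equiv.symm_apply_eq]
    rfl
  rw [hb, μ.act_act]
  rfl

/-- A faithful action on `d` points is an embedding into the self-maps of these points; the opposite
monoid accounts for composition from left to right. -/
theorem deg_le_degRC (S : Type*) [Semigroup S] : deg S ≤ degRC S := by
  refine sInf_le_sInf ?_
  rintro m ⟨d, hd, rfl, μ, -, hμ⟩
  refine ⟨d, hd, rfl, ⟨fun a => MulOpposite.op fun x => μ.act x a, fun a b => ?_⟩, ?_⟩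
  · refine MulOpposite.unop_injective (funext fun x => ?_)
    exact (μ.act_act x a b).symm
  · intro a b h
    exact hμ a b fun x => congrFun (MulOpposite.op_injective h) x

theorem degRC_le_card {M X : Type*} [Monoid M] [Finite X] [Nonempty X] (μ : RightAction M X)
    (h1 : ∀ x, μ.act x 1 = x) (hf : μ.Faithful) (hm : μ.Monogenic) :
    degRC M ≤ (Nat.card X : ℕ∞) := by
  refine sInf_le ⟨Nat.card X, Nat.card_pos, rfl, μ.transport (Finite.equivFin X),
    (hm.transport _).isRightCongruenceAction fun x => ?_, hf.transport _⟩
  simp [RightAction.transport, h1]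

end Actions

/-! ### The join of the Rees right congruence with `L^U`. -/

section Sigma

variable {M : Type*} [Monoid M]

theorem relativeL_iff {U : Submonoid M} {a b : M} :
    (relativeL U).rel a b ↔ (∃ u ∈ U, b = u * a) ∧ ∃ u ∈ U, a = u * b := by
  change {x | ∃ u ∈ U, x = u * a} = {x | ∃ u ∈ U, x = u * b} ↔ _
  constructor
  · intro h
    exact ⟨(Set.ext_iff.1 h b).2 ⟨1, U.one_mem, (one_mul b).symm⟩,
      (Set.ext_iff.1 h a).1 ⟨1, U.one_mem, (one_mul a).symm⟩⟩
  · rintro ⟨⟨u, hu, hb⟩, v, hv, ha⟩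
    refine Set.Subset.antisymm ?_ ?_
    · rintro _ ⟨w, hw, rfl⟩
      exact ⟨w * v, U.mul_mem hw hv, by rw [mul_assoc, ← ha]⟩
    · rintro _ ⟨w, hw, rfl⟩
      exact ⟨w * u, U.mul_mem hw hu, by rw [mul_assoc, ← hb]⟩

/-- With `z = a * s`, membership of `u` in `T` makes `u * z` lie in the `R`-class of `z`, so `z = u
* z * t = u * a * (s * t)`. -/
theorem mul_mem_setK {z u a : M} (hu : u ∈ setT z) (ha : a ∈ setK z) : u * a ∈ setK z := by
  obtain ⟨s, hs⟩ := ha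
  obtain ⟨-, t, ht⟩ := hu z ⟨⟨1, (mul_one z).symm⟩, ⟨1, (mul_one z).symm⟩⟩
  refine ⟨s * t, ?_⟩
  rw [mul_assoc u a, ← mul_assoc a, ← hs, ← mul_assoc]
  exact ht

/-- Classes of the join of the Rees right congruence of `I` and `L^U`, for a submonoid `U` of `T`. -/
theorem join_rees_relativeL_imp {z : M} {U : Submonoid M} (hU : U ≤ setT z) {a b : M}
    (h : (RightCongruence.join (RightCongruence.rees (setI z) (setI_mul_mem z))
      (relativeL U)).rel a b) :
    (a ∈ setI z ∧ b ∈ setI z) ∨ (a ∈ setK z ∧ b ∈ setK z ∧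
      (∃ u ∈ U, b = u * a) ∧ ∃ u ∈ U, a = u * b) := by
  -- A candidate for the join: one class on `I`, and `L^U` on `K`. It is an equivalence containing
  -- both generators, so it contains the join.
  let τ : Setoid M :=
    { r := fun a b => (a ∈ setI z ∧ b ∈ setI z) ∨ (a ∈ setK z ∧ b ∈ setK z ∧
        (relativeL U).rel a b)
      iseqv :=
        { refl := fun a => (em (a ∈ setK z)).symm.imp (fun h => ⟨h, h⟩)
            fun h => ⟨h, h, (relativeL U).rel.refl' a⟩
          symm := by
            rintro a b (⟨h1, h2⟩ | ⟨h1, h2, h3⟩)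
            · exact Or.inl ⟨h2, h1⟩
            · exact Or.inr ⟨h2, h1, (relativeL U).rel.symm' h3⟩
          trans := by
            rintro a b c (⟨h1, h2⟩ | ⟨h1, h2, h3⟩) (⟨h4, h5⟩ | ⟨h4, h5, h6⟩)
            · exact Or.inl ⟨h1, h5⟩
            · exact absurd h4 h2
            · exact absurd h2 h4
            · exact Or.inr ⟨h1, h5, (relativeL U).rel.trans' h3 h6⟩ } }
  have hle : (RightCongruence.join (RightCongruence.rees (setI z) (setI_mul_mem z))
      (relativeL U)).rel ≤ τ := by
    refine sup_le ?_ ?_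
    · rintro a b (rfl | h)
      · exact τ.refl' _
      · exact Or.inl h
    · intro a b hab
      obtain ⟨⟨u, hu, hb⟩, v, hv, ha⟩ := relativeL_iff.1 hab
      by_cases h : a ∈ setK z
      · exact Or.inr ⟨h, hb ▸ mul_mem_setK (hU hu) h, hab⟩
      · refine Or.inl ⟨h, fun h' => h ?_⟩
        rw [ha]
        exact mul_mem_setK (hU hv) h'
  obtain h | ⟨h1, h2, h3⟩ := hle h
  · exact Or.inl h
  · exact Or.inr ⟨h1, h2, relativeL_iff.1 h3⟩

end Sigma

end DiagramMonoid

namespace DiagramMonoid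

open PartitionDiagram

namespace Brauer

variable {n : ℕ}

/-! ### Elements above `ζ`, and the rank `3` generator `core`. -/

section Kappa

theorem uu_zeta {x y : Fin n} : UU (zeta n) x y ↔ label n x = label n y := by
  refine Prod.ext_iff.trans ⟨fun h => h.1, fun h => ⟨h, ?_⟩⟩
  change decide (Odd n ∧ label n x = 0) = decide (Odd n ∧ label n y = 0)
  rw [h]

theorem ul_zeta {x y : Fin n} :
    UL (zeta n) x y ↔ label n x = label n y ∧ Odd n ∧ label n x = 0 :=
  Prod.ext_iff.trans (and_congr Iff.rfl decide_eq_true_iff)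

theorem label_eq (hn : Odd n) (x : Fin n) : label n x = (x.1 + 1) / 2 := if_pos hn

/-- The involution of the vertices whose orbits are the `κ`-classes. -/
noncomputable def kappa (n : ℕ) : Fin n → Fin n := (exists_hook (zeta n)).choose

theorem kappa_kappa (x : Fin n) : kappa n (kappa n x) = x :=
  (exists_hook (zeta n)).choose_spec.1 x

theorem uu_zeta_iff_kappa {x y : Fin n} : UU (zeta n) x y ↔ y = x ∨ y = kappa n x :=
  (exists_hook (zeta n)).choose_spec.2.1 x y

theorem label_kappa (x : Fin n) : label n (kappa n x) = label n x :=
  (uu_zeta.1 (uu_zeta_iff_kappa.2 (Or.inr rfl))).symm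

theorem kappa_eq_self (hn : Odd n) {x : Fin n} : kappa n x = x ↔ x.1 = 0 := by
  refine ((exists_hook (zeta n)).choose_spec.2.2 x).trans ?_
  simp only [ul_zeta, label_eq hn]
  constructor
  · rintro ⟨y, -, -, h⟩
    omega
  · intro h
    exact ⟨x, rfl, hn, by omega⟩

/-- Elements above `ζ` do not involve the first upper vertex in a hook. -/
theorem exists_ul_of_mem_setK (hn : Odd n) {α : Brauer n} (hα : α ∈ setK (zeta n)) {o : Fin n}
    (ho : o.1 = 0) : ∃ y, UL α o y := by
  obtain ⟨z, hz, h⟩ | h := upper_cases α o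
  · obtain h | h := uu_zeta_iff_kappa.1 (mem_setK.1 hα _ _ h)
    · exact absurd h hz
    · exact absurd (h.trans ((kappa_eq_self hn).2 ho)) hz
  · exact h

/-- Hooks of elements of `K` are whole `κ`-classes, so the two vertices of a class are hooked
together or both start transversals. -/
theorem exists_ul_kappa {α : Brauer n} (hα : α ∈ setK (zeta n)) {x y : Fin n} (h : UL α x y) :
    ∃ z, UL α (kappa n x) z := by
  obtain ⟨z, hz, hxz⟩ | h' := upper_cases α (kappa n x)
  · obtain e | e := uu_zeta_iff_kappa.1 (mem_setK.1 hα _ _ hxz)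
    · exact absurd e hz
    · rw [kappa_kappa] at e
      subst e
      exact absurd (h.eq_of_uu hxz.symm).symm hz
  · exact h'

/-- The projection of rank `3` obtained from `ζ` by removing the hook at the vertices labelled by
`1`. -/
noncomputable def core (n : ℕ) : Brauer n :=
  ofHooks (fun x => if label n x ≤ 1 then x else kappa n x) fun x => by
    by_cases h : label n x ≤ 1
    · simp [h]
    · simp [h, label_kappa, kappa_kappa]

theorem uu_core_kappa {x : Fin n} (h : 1 < label n x) : UU (core n) x (kappa n x) :=
  uu_ofHooks.2 (Or.inr (by simp [Nat.not_le.2 h]))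

theorem ll_core_kappa {x : Fin n} (h : 1 < label n x) : LL (core n) x (kappa n x) :=
  ll_ofHooks.2 (Or.inr (by simp [Nat.not_le.2 h]))

theorem ul_core {x : Fin n} (h : label n x ≤ 1) : UL (core n) x x :=
  ul_ofHooks.2 ⟨rfl, by simp [h]⟩

theorem core_mem_setK : core n ∈ setK (zeta n) := by
  rw [mem_setK]
  intro x y h
  obtain h | h := uu_ofHooks.1 h
  · rw [h]
    exact UU.refl _ _
  · rw [uu_zeta_iff_kappa]
    by_cases hx : label n x ≤ 1
    · exact Or.inl (by simpa [hx] using h)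
    · exact Or.inr (by simpa [hx] using h)

theorem rank_core (hn : Odd n) (hn3 : 3 ≤ n) : (core n).1.rank = 3 := by
  have e : {x | ∃ y, UL (core n) x y} =
      {(⟨0, by omega⟩ : Fin n), (⟨1, by omega⟩ : Fin n), (⟨2, by omega⟩ : Fin n)} := by
    ext x
    have hx : (∃ y, UL (core n) x y) ↔ label n x ≤ 1 := by
      refine ⟨?_, fun h => ⟨x, ul_core h⟩⟩
      rintro ⟨y, h⟩
      by_contra hx
      have h1 := h.eq_of_uu (uu_core_kappa (not_le.1 hx))
      rw [kappa_eq_self hn] at h1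
      rw [label_eq hn] at hx
      omega
    rw [Set.mem_ofPred_eq, hx, label_eq hn]
    simp only [Set.mem_insert_iff, Set.mem_singleton_iff, Fin.ext_iff]
    omega
  rw [rank_eq_upper, e, Set.ncard_eq_three]
  exact ⟨_, _, _, by simp, by simp, by simp, rfl⟩

/-- The hooks of `core n` persist in the product and are `κ`-classes. Only the vertices `0`, `1`,
`2` remain; if `0` starts a transversal, the sole further hook possible is `{1,2}`, again a
`κ`-class. -/
theorem core_mul_mem_setK (hn : Odd n) {s : Brauer n} {o y : Fin n} (ho : o.1 = 0)
    (h : UL (core n * s) o y) : core n * s ∈ setK (zeta n) := by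
  rw [mem_setK]
  have big : ∀ x z, 1 < label n x → UU (core n * s) x z → UU (zeta n) x z := by
    intro x z hx hz
    rw [uu_zeta_iff_kappa]
    by_cases hzx : z = x
    · exact Or.inl hzx
    refine Or.inr (hz.unique ((uu_core_kappa hx).mul_right s) hzx ?_)
    rw [Ne, kappa_eq_self hn]
    rw [label_eq hn] at hx
    omega
  intro x z hz
  by_cases hx : 1 < label n x
  · exact big x z hx hz
  by_cases hz' : 1 < label n z
  · exact (big z x hz' hz.symm).symm
  by_cases hxo : x = o
  · subst hxo
    rw [h.eq_of_uu hz]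
    exact UU.refl _ _
  by_cases hzo : z = o
  · subst hzo
    rw [h.eq_of_uu hz.symm]
    exact UU.refl _ _
  rw [uu_zeta]
  rw [label_eq hn] at *
  rw [Fin.ext_iff] at hxo hzo
  rw [label_eq hn] at *
  omega

end Kappa

/-! ### Faithfulness. -/

section Faithful

theorem exists_perm_map {m : ℕ} {f g : Fin m → Fin n} (hf : f.Injective) (hg : g.Injective) :
    ∃ π : Equiv.Perm (Fin n), ∀ i, π (f i) = g i := by
  have := Equiv.Perm.isMultiplyPretransitive (Fin n) m
  obtain ⟨π, h⟩ := MulAction.exists_smul_eq (Equiv.Perm (Fin n))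
    (⟨f, hf⟩ : Fin m ↪ Fin n) ⟨g, hg⟩
  exact ⟨π, fun i => DFunLike.congr_fun h i⟩

/-- The rank is congruent to the odd number `n` modulo `2`, hence nonzero. -/
theorem exists_ul (hn : Odd n) (α : Brauer n) : ∃ x y, UL α x y := by
  have h := rank_modEq α
  by_contra! hne
  have e : {x | ∃ y, UL α x y} = ∅ := Set.eq_empty_of_forall_notMem fun x ⟨y, hy⟩ => hne x y hy
  rw [rank_eq_upper, e, Set.ncard_empty] at h
  have h2 : n % 2 = 0 := h
  have := Nat.odd_iff.1 hn
  omega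

/-- The hook `{x, y}` of `β` is pulled back to `{0, 1}`, which is not contained in a `κ`-class. -/
theorem core_mul_perm_notMem_setK (hn : Odd n) {π : Equiv.Perm (Fin n)} {β : Brauer n}
    {o i x y : Fin n} (ho : o.1 = 0) (hi : i.1 = 1) (hx : π o = x) (hy : π i = y)
    (h : UU β x y) : core n * ofPerm π * β ∉ setK (zeta n) := by
  intro hK
  have hox : UL (core n * ofPerm π) o x :=
    (ul_core (by rw [label_eq hn]; omega)).mul (hx ▸ ul_ofPerm π o)
  have hiy : UL (core n * ofPerm π) i y :=
    (ul_core (by rw [label_eq hn]; omega)).mul (hy ▸ ul_ofPerm π i)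
  have := uu_zeta.1 (mem_setK.1 hK _ _ (h.mul_of_ul hox hiy))
  rw [label_eq hn, label_eq hn] at this
  omega

/-- Diagrams with different upper hooks are separated by a product that falls into `I` for exactly
one of them. -/
theorem exists_separating (hn : Odd n) (hn3 : 3 ≤ n) {β γ : Brauer n} {x y : Fin n}
    (hβ : UU β x y) (hγ : ¬ UU γ x y) :
    ∃ π : Equiv.Perm (Fin n), core n * ofPerm π * β ∉ setK (zeta n) ∧
      core n * ofPerm π * γ ∈ setK (zeta n) := by
  have hxy : x ≠ y := by
    rintro rfl
    exact hγ (UU.refl _ _)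
  let v : Fin 3 → Fin n := Fin.castLE hn3
  -- Easy case: if one end of the hook of `β` starts a transversal of `γ`, put that end under the
  -- vertex `0`. The product with `γ` then has a transversal at `0`, so it lies in `K`.
  have transversal : ∀ a b, a ≠ b → UU β a b → (∃ z, UL γ a z) →
      ∃ π : Equiv.Perm (Fin n), core n * ofPerm π * β ∉ setK (zeta n) ∧
      core n * ofPerm π * γ ∈ setK (zeta n) := by
    rintro a b hab h ⟨z, hz⟩
    obtain ⟨π, hπ⟩ := exists_perm_map (n := n) (f := ![v 0, v 1]) (g := ![a, b])
      (by intro i j; fin_cases i <;> fin_cases j <;> simp [v, Fin.ext_iff])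
      (by intro i j; fin_cases i <;> fin_cases j <;> simp [hab, hab.symm])
    have h0 : π (v 0) = a := hπ 0
    refine ⟨π, core_mul_perm_notMem_setK hn (o := v 0) (i := v 1) rfl rfl h0 (hπ 1) h, ?_⟩
    have : UL (core n * ofPerm π) (v 0) a :=
      (ul_core (by rw [label_eq hn]; simp [v])).mul (h0 ▸ ul_ofPerm π (v 0))
    rw [mul_assoc]
    refine core_mul_mem_setK hn (o := v 0) (y := z) rfl ?_
    rw [← mul_assoc]
    exact this.mul hz
  obtain ⟨w, hwx, hxw⟩ | hx := upper_cases γ x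
  swap
  · exact transversal x y hxy hβ hx
  obtain ⟨w', hw', hyw'⟩ | hy := upper_cases γ y
  swap
  · exact transversal y x hxy.symm hβ.symm hy
  -- Remaining case: both `x` and `y` lie in hooks of `γ`. The vertex `0` must then reach a
  -- transversal of `γ` by a detour through the partner `w` of `x`.
  obtain ⟨t, z, htz⟩ := exists_ul hn γ
  have hwy : w ≠ y := by
    rintro rfl
    exact hγ hxw
  have htx : t ≠ x := by
    rintro rfl
    exact hwx (htz.eq_of_uu hxw)
  have hty : t ≠ y := by
    rintro rfl
    exact hw' (htz.eq_of_uu hyw')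
  have htw : t ≠ w := by
    rintro rfl
    exact hwx (htz.eq_of_uu hxw.symm).symm
  have hg : Function.Injective ![x, y, w, t] := by
    intro i j
    fin_cases i <;> fin_cases j <;>
      simp [hxy, hxy.symm, hwx, hwx.symm, hwy, hwy.symm, htx, htx.symm, hty, hty.symm, htw, htw.symm]
  have h4 : 4 ≤ n := by simpa using Fintype.card_le_of_injective _ hg
  -- Four distinct vertices and odd `n` leave room for the `κ`-class `{3, 4}`.
  have h5 : 5 ≤ n := by
    obtain ⟨m, rfl⟩ := hn
    omega
  let w5 : Fin 5 → Fin n := Fin.castLE h5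
  -- The lower hook `{3, 4}` of `core n` is carried to `{w, t}`. In the product with `γ` the path
  -- from `0` runs to `x`, to `w` in `γ`, to `t` along this hook, and down to `z`. In the product
  -- with `β` the hook `{x, y}` still closes up `{0, 1}`.
  obtain ⟨π, hπ⟩ := exists_perm_map (n := n) (f := ![w5 0, w5 1, w5 3, w5 4]) (g := ![x, y, w, t])
    (by intro i j; fin_cases i <;> fin_cases j <;> simp [w5, Fin.ext_iff]) hg
  have h0 : π (w5 0) = x := hπ 0
  have h2 : π (w5 3) = w := hπ 2
  have h3 : π (w5 4) = t := hπ 3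
  refine ⟨π, core_mul_perm_notMem_setK hn (o := w5 0) (i := w5 1) rfl rfl h0 (hπ 1) hβ, ?_⟩
  have hx0 : UL (core n * ofPerm π) (w5 0) x :=
    (ul_core (by rw [label_eq hn]; simp [w5])).mul (h0 ▸ ul_ofPerm π (w5 0))
  have hk : w5 4 = kappa n (w5 3) := by
    have : UU (zeta n) (w5 3) (w5 4) := by
      rw [uu_zeta, label_eq hn, label_eq hn]
      simp [w5]
    exact (uu_zeta_iff_kappa.1 this).resolve_left (by simp [w5, Fin.ext_iff])
  have hwt : LL (core n * ofPerm π) w t := by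
    refine LL.mul_of_ul (p := w5 3) (q := w5 4) ?_ (h2 ▸ ul_ofPerm π _) (h3 ▸ ul_ofPerm π _)
    rw [hk]
    refine ll_core_kappa ?_
    rw [label_eq hn]
    simp [w5]
  rw [mul_assoc]
  refine core_mul_mem_setK hn (o := w5 0) (y := z) rfl ?_
  rw [← mul_assoc]
  exact hx0.mul_zigzag hxw hwt htz

theorem ll_mul_of_eq_mul {α β u : Brauer n} (h : α = u * β) {x y : Fin n} (hβ : LL β x y) :
    LL α x y := h ▸ hβ.mul_left u

/-- The action on the classes of the elements of `core n * B_n` separates the elements of `B_n`. -/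
theorem eq_of_forall_core_mul (hn : Odd n) (hn3 : 3 ≤ n) {β γ : Brauer n}
    (h : ∀ s, (sigma n).rel (core n * s * β) (core n * s * γ)) : β = γ := by
  have hU : U n ≤ setT (zeta n) := inf_le_left
  have hK : ∀ s, core n * s * β ∈ setK (zeta n) ↔ core n * s * γ ∈ setK (zeta n) := by
    intro s
    obtain ⟨h1, h2⟩ | ⟨h1, h2, -⟩ := join_rees_relativeL_imp hU (h s)
    · exact ⟨fun h => absurd h h1, fun h => absurd h h2⟩
    · exact ⟨fun _ => h2, fun _ => h1⟩
  have hL : ∀ s, core n * s * β ∈ setK (zeta n) → ∀ x y,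
      LL (core n * s * β) x y ↔ LL (core n * s * γ) x y := by
    intro s hs x y
    obtain ⟨h1, h2⟩ | ⟨-, -, ⟨u, -, hu⟩, w, -, hw⟩ := join_rees_relativeL_imp hU (h s)
    · exact absurd hs h1
    · exact ⟨ll_mul_of_eq_mul hu, ll_mul_of_eq_mul hw⟩
  have huu : ∀ x y, UU β x y ↔ UU γ x y := by
    intro x y
    by_contra hne
    by_cases hβ : UU β x y
    · obtain ⟨π, h1, h2⟩ := exists_separating hn hn3 hβ fun hγ => hne (iff_of_true hβ hγ)
      exact h1 ((hK _).2 h2)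
    · obtain ⟨π, h1, h2⟩ := exists_separating hn hn3 (by_contra fun hγ =>
        hne (iff_of_false hβ hγ)) hβ
      exact h1 ((hK _).1 h2)
  -- `ζ` itself lies in `core n * B_n`, so rank `1` test elements are available.
  obtain ⟨s, hs⟩ := leR_iff.2 (mem_setK.1 (core_mem_setK (n := n)))
  let o : Fin n := ⟨0, by omega⟩
  have ho : UL (zeta n) o o := by
    rw [ul_zeta, label_eq hn]
    exact ⟨rfl, hn, by simp [o]⟩
  -- multiplication by `ζ` and a permutation moving the first vertex to a given transversal
  have hsep : ∀ a b, UL β a b → ∃ t, UL (core n * t * β) o b ∧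
      core n * t * β ∈ setK (zeta n) ∧ (∀ c, UL γ a c → UL (core n * t * γ) o c) ∧
      ∀ x, x ≠ o → ∃ y, y ≠ x ∧ UU (core n * t * β) x y := by
    intro a b hab
    refine ⟨s * ofPerm (Equiv.swap o a), ?_⟩
    have hoa : UL (core n * (s * ofPerm (Equiv.swap o a))) o a := by
      rw [← mul_assoc, ← hs]
      refine ho.mul ?_
      simpa using ul_ofPerm (Equiv.swap o a) o
    refine ⟨hoa.mul hab, ?_, fun c hc => hoa.mul hc, fun x hx => ⟨kappa n x, ?_, ?_⟩⟩
    · rw [mul_assoc]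
      refine core_mul_mem_setK hn (o := o) (y := b) rfl ?_
      rw [← mul_assoc]
      exact hoa.mul hab
    · rw [Ne, kappa_eq_self hn]
      simpa [o, Fin.ext_iff] using hx
    · rw [← mul_assoc, ← hs]
      exact ((uu_zeta_iff_kappa.2 (Or.inr rfl)).mul_right _).mul_right _
  have hul : ∀ a b, UL β a b → UL γ a b := by
    intro a b hab
    obtain ⟨t, h1, h2, h3, h4⟩ := hsep a b hab
    obtain ⟨z, hz, haz⟩ | ⟨c, hc⟩ := upper_cases γ a
    · exact absurd (hab.eq_of_uu ((huu a z).2 haz)) hz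
    -- The lower end `c` of the transversal of `γ` at `a` lies in no lower hook of the product with
    -- `γ`, hence in none of the product with `β`. The latter has only the transversal from `o` to
    -- `b`, so `c = b`.
    obtain ⟨z, hz, hcz⟩ | ⟨x, hx⟩ := lower_cases (core n * t * β) c
    · exact absurd ((h3 c hc).eq_of_ll ((hL t h2 _ _).1 hcz)) hz
    · by_cases hxo : x = o
      · subst hxo
        rwa [h1.unique_lower hx]
      · obtain ⟨y, hy, hxy⟩ := h4 x hxo
        exact absurd (hx.eq_of_uu hxy) hy
  refine eq_of_rel_imp (fun x y => (huu x y).1) hul fun p q hpq => ?_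
  by_cases hqp : q = p
  · rw [hqp]
    exact LL.refl _ _
  obtain ⟨a, b, hab⟩ := exists_ul hn β
  obtain ⟨t, -, h2, -, -⟩ := hsep a b hab
  obtain ⟨r, hr, hpr⟩ | ⟨x, hx⟩ := lower_cases γ p
  · have h5 := (hL t h2 _ _).1 (hpq.mul_left _)
    rwa [h5.unique (hpr.mul_left _) hqp hr]
  -- If `p` ended a transversal of `γ` from `x`, then `β` would have a transversal at `x` too,
  -- because the upper hooks agree. By `hul` it would end at `p`, against the hook `{p, q}` of `β`.
  · obtain ⟨y, hy, hxy⟩ | ⟨y, hy⟩ := upper_cases β x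
    · exact absurd (hx.eq_of_uu ((huu x y).1 hxy)) hy
    · rw [(hul x y hy).unique_lower hx] at hy
      exact absurd (hy.eq_of_ll hpq) hqp

end Faithful

/-! ### Invariants of the `σ`-classes in `K`. -/

section Classes

theorem one_ul (x : Fin n) : UL (1 : Brauer n) x x := (rfl : x = x)

theorem ofPerm_mul_self {π : Equiv.Perm (Fin n)} (hπ : ∀ x, π (π x) = x) :
    ofPerm π * ofPerm π = 1 := by
  symm
  refine eq_of_rel_imp (fun x y h => ?_) (fun x y h => ?_) (fun x y h => ?_)
  · rw [(one_ul x).eq_of_uu h]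
    exact UU.refl _ _
  · rw [← (one_ul x).unique_lower h]
    have := (ul_ofPerm π x).mul (ul_ofPerm π (π x))
    rwa [hπ] at this
  · rw [(one_ul x).eq_of_ll h]
    exact LL.refl _ _

theorem uu_ofPerm_mul {π : Equiv.Perm (Fin n)} (hπ : ∀ x, π (π x) = x) {α : Brauer n}
    {x y : Fin n} : UU (ofPerm π * α) x y ↔ UU α (π x) (π y) := by
  have key : ∀ (β : Brauer n) x y, UU β (π x) (π y) → UU (ofPerm π * β) x y := fun β x y h =>
    h.mul_of_ul (ul_ofPerm π x) (ul_ofPerm π y)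
  refine ⟨fun h => ?_, key α x y⟩
  have := key (ofPerm π * α) (π x) (π y) (by rwa [hπ, hπ])
  rwa [← mul_assoc, ofPerm_mul_self hπ, one_mul] at this

/-- An involution commuting with `κ` gives an element of `U`. -/
theorem ofPerm_mem_U {π : Equiv.Perm (Fin n)} (hπ : ∀ x, π (π x) = x)
    (hk : ∀ x, π (kappa n x) = kappa n (π x)) : ofPerm π ∈ U n := by
  refine ⟨fun α hα => ?_, ⟨⟨_, _, ofPerm_mul_self hπ, ofPerm_mul_self hπ⟩, rfl⟩⟩
  rw [mem_rClass] at hα ⊢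
  intro x y
  rw [uu_ofPerm_mul hπ, hα, uu_zeta_iff_kappa, uu_zeta_iff_kappa, ← hk, π.injective.eq_iff,
    π.injective.eq_iff]

theorem exists_involution_commuting {X : Type*} [DecidableEq X] {k : X → X}
    (hk : ∀ x, k (k x) = x) {a c : X} (ha : k a ≠ a) (hc : k c ≠ c) :
    ∃ π : Equiv.Perm X, (∀ x, π (π x) = x) ∧ (∀ x, π (k x) = k (π x)) ∧ π c = a := by
  -- Exchange `{a, k a}` with `{c, k c}`. The order of the tests also covers coinciding classes: the
  -- identity for `c = a`, and the swap of `a` with `k a` for `c = k a`.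
  let f : X → X := fun x =>
    if x = c then a else if x = k c then k a else if x = a then c else if x = k a then k c else x
  have hf : ∀ x, f (f x) = x := by
    intro x
    grind
  exact ⟨⟨f, f, hf, hf⟩, hf, fun x => by change f (k x) = k (f x); grind, if_pos rfl⟩

variable {α β : Brauer n}

/-- The projection `star α * α` remembers the lower hooks of `α`: they become its upper hooks,
whereas lower ends of transversals give vertical blocks. -/
theorem ll_of_star_mul_eq (h : star α * α = star β * β) {x y : Fin n} (hxy : LL α x y) :
    LL β x y := by
  by_cases hne : y = x
  · rw [hne]
    exact LL.refl _ _
  have h1 : UU (star β * β) x y := h ▸ UU.mul_right (uu_star.2 hxy) α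
  obtain ⟨z, hz, hxz⟩ | ⟨z, hz⟩ := lower_cases β x
  · rwa [h1.unique (UU.mul_right (uu_star.2 hxz) β) hne hz]
  · exact absurd (((ul_star.2 hz).mul hz).eq_of_uu h1) hne

theorem exists_ul_lower_of_star_mul_eq (h : star α * α = star β * β) {x y : Fin n}
    (hxy : UL α x y) : ∃ z, UL β z y := by
  obtain ⟨z, hz, hyz⟩ | h' := lower_cases β y
  · exact absurd (hxy.eq_of_ll (ll_of_star_mul_eq h.symm hyz)) hz
  · exact h'

theorem uu_kappa_of_forall_not_ul (hα : α ∈ setK (zeta n)) {x : Fin n} (h : ∀ y, ¬ UL α x y) :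
    UU α x (kappa n x) := by
  obtain ⟨z, hz, hxz⟩ | ⟨y, hy⟩ := upper_cases α x
  · obtain e | e := uu_zeta_iff_kappa.1 (mem_setK.1 hα _ _ hxz)
    · exact absurd e hz
    · rwa [← e]
  · exact absurd hy (h y)

theorem eq_kappa_of_uu (hα : α ∈ setK (zeta n)) {x y : Fin n} (h : UU α x y) (hne : y ≠ x) :
    y = kappa n x :=
  (uu_zeta_iff_kappa.1 (mem_setK.1 hα _ _ h)).resolve_left hne

theorem eq_of_rank_eq_one (hn : Odd n) (hα : α ∈ setK (zeta n)) (hr : α.1.rank = 1)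
    {o x y : Fin n} (ho : o.1 = 0) (hxy : UL α x y) : x = o := by
  rw [rank_eq_upper, Set.ncard_eq_one] at hr
  obtain ⟨w, hw⟩ := hr
  have h1 : x = w := (Set.ext_iff.1 hw x).1 ⟨y, hxy⟩
  have h2 : o = w := (Set.ext_iff.1 hw o).1 (exists_ul_of_mem_setK hn hα ho)
  rw [h1, h2]

/-- An element of rank `1` above `ζ` is determined by its projection. -/
theorem eq_of_star_mul_eq (hn : Odd n) (hα : α ∈ setK (zeta n)) (hβ : β ∈ setK (zeta n))
    (hrα : α.1.rank = 1) (hrβ : β.1.rank = 1) (h : star α * α = star β * β) : α = β := by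
  let o : Fin n := ⟨0, hn.pos⟩
  refine eq_of_rel_imp (fun x y hxy => ?_) (fun x y hxy => ?_)
    fun x y hxy => ll_of_star_mul_eq h hxy
  · by_cases hne : y = x
    · rw [hne]
      exact UU.refl _ _
    rw [eq_kappa_of_uu hα hxy hne]
    refine uu_kappa_of_forall_not_ul hβ fun z hz => ?_
    obtain rfl := eq_of_rank_eq_one hn hβ hrβ (o := o) rfl hz
    obtain ⟨w, hw⟩ := exists_ul_of_mem_setK hn hα (o := o) rfl
    exact hne (hw.eq_of_uu hxy)
  · obtain ⟨z, hz⟩ := exists_ul_lower_of_star_mul_eq h hxy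
    rw [eq_of_rank_eq_one hn hα hrα (o := o) rfl hxy]
    rwa [eq_of_rank_eq_one hn hβ hrβ (o := o) rfl hz] at hz

/-- In rank `3`, the transversals of an element above `ζ` start at the first vertex and at the two
vertices of a `κ`-class. -/
theorem eq_or_eq_or_eq_of_rank_eq_three (hn : Odd n) (hα : α ∈ setK (zeta n))
    (hr : α.1.rank = 3) {o a p x y : Fin n} (ho : o.1 = 0) (ha : UL α a p) (hao : a ≠ o)
    (hx : UL α x y) : x = o ∨ x = a ∨ x = kappa n a := by
  have hko : kappa n o = o := (kappa_eq_self hn).2 ho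
  have hka : kappa n a ≠ a := by
    rw [Ne, kappa_eq_self hn]
    rwa [Ne, Fin.ext_iff, ho] at hao
  have hkao : kappa n a ≠ o := by
    intro e
    rw [← e, kappa_kappa, e] at hko
    exact hao hko
  have hsub : ({o, a, kappa n a} : Set (Fin n)) ⊆ {x | ∃ y, UL α x y} := by
    rintro z (rfl | rfl | rfl)
    · exact exists_ul_of_mem_setK hn hα ho
    · exact ⟨p, ha⟩
    · exact exists_ul_kappa hα ha
  have hcard : ({o, a, kappa n a} : Set (Fin n)).ncard = 3 :=
    Set.ncard_eq_three.2 ⟨_, _, _, hao.symm, hkao.symm, hka.symm, rfl⟩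
  have heq := Set.eq_of_subset_of_ncard_le hsub (by rw [hcard, ← rank_eq_upper, hr])
    (Set.toFinite _)
  exact (Set.ext_iff.1 heq x).2 ⟨y, hx⟩

/-- Elements of rank `3` above `ζ` with the same projection, and with the same transversal at the
first lower vertex, differ by an element of `U`. -/
theorem exists_mem_U_eq_mul (hn : Odd n) (hα : α ∈ setK (zeta n)) (hβ : β ∈ setK (zeta n))
    (hrα : α.1.rank = 3) (hrβ : β.1.rank = 3) (h : star α * α = star β * β) {o p : Fin n}
    (ho : o.1 = 0) (hpα : UL α o p) (hpβ : UL β o p) : ∃ u ∈ U n, β = u * α := by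
  have hko : kappa n o = o := (kappa_eq_self hn).2 ho
  have hfix : ∀ {x}, kappa n x = x → x = o := fun hx =>
    Fin.ext (((kappa_eq_self hn).1 hx).trans ho.symm)
  -- A second lower end `q` is joined to `a` in `α` and to `c` in `β`. The third one, `r`, is joined
  -- to `kappa n c` in `β`, and by elimination to `kappa n a` in `α`. So exchanging the `κ`-classes
  -- of `a` and `c` matches all three transversals.
  obtain ⟨q, ⟨a, ha⟩, hqp⟩ : ∃ q ∈ {y | ∃ x, UL α x y}, q ≠ p :=
    Set.exists_ne_of_one_lt_ncard (by rw [← rank_eq_lower, hrα]; norm_num) p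
  obtain ⟨c, hc⟩ := exists_ul_lower_of_star_mul_eq h ha
  have hao : a ≠ o := by
    rintro rfl
    exact hqp (ha.unique_lower hpα)
  have hco : c ≠ o := by
    rintro rfl
    exact hqp (hc.unique_lower hpβ)
  obtain ⟨r, hr⟩ := exists_ul_kappa hβ hc
  obtain ⟨x, hx⟩ := exists_ul_lower_of_star_mul_eq h.symm hr
  have hxa : UL α (kappa n a) r := by
    obtain rfl | rfl | rfl := eq_or_eq_or_eq_of_rank_eq_three hn hα hrα ho ha hao hx
    · rw [hpα.unique_lower hx] at hpβ
      have := hr.unique_upper hpβ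
      rw [← this, kappa_kappa] at hko
      exact absurd (hko.trans this) hco
    · rw [ha.unique_lower hx] at hc
      exact absurd (hfix (hr.unique_upper hc)) hco
    · exact hx
  obtain ⟨π, h1, h2, h3⟩ := exists_involution_commuting (k := kappa n) kappa_kappa
    (fun e => hao (hfix e)) (fun e => hco (hfix e))
  have h4 : π (kappa n c) = kappa n a := by rw [h2, h3]
  have h5 : π o = o := hfix (by rw [← h2, hko])
  refine ⟨ofPerm π, ofPerm_mem_U h1 h2, ?_⟩
  have transfer : ∀ {x y z}, π x = z → UL α z y → UL (ofPerm π * α) x y := by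
    rintro x y z rfl hz
    exact (ul_ofPerm π x).mul hz
  refine eq_of_rel_imp (fun x y hxy => ?_) (fun x y hxy => ?_) fun x y hxy => ?_
  · by_cases hne : y = x
    · rw [hne]
      exact UU.refl _ _
    rw [uu_ofPerm_mul h1, eq_kappa_of_uu hβ hxy hne, h2]
    refine uu_kappa_of_forall_not_ul hα fun z hz => hne ?_
    obtain e | e | e := eq_or_eq_or_eq_of_rank_eq_three hn hα hrα ho ha hao hz
    · rw [← h5, π.injective.eq_iff] at e
      subst e
      exact hpβ.eq_of_uu hxy
    · rw [← h3, π.injective.eq_iff] at e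
      subst e
      exact hc.eq_of_uu hxy
    · rw [← h4, π.injective.eq_iff] at e
      subst e
      exact hr.eq_of_uu hxy
  · obtain rfl | rfl | rfl := eq_or_eq_or_eq_of_rank_eq_three hn hβ hrβ ho hc hco hxy
    · rw [hxy.unique_lower hpβ]
      exact transfer h5 hpα
    · rw [hxy.unique_lower hc]
      exact transfer h3 ha
    · rw [hxy.unique_lower hr]
      exact transfer h4 hxa
  · exact (ll_of_star_mul_eq h.symm hxy).mul_left _

theorem sigma_rel_of_mem_setI (hα : α ∈ setI (zeta n)) (hβ : β ∈ setI (zeta n)) :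
    (sigma n).rel α β :=
  (le_sup_left : (RightCongruence.rees (setI (zeta n)) (setI_mul_mem (zeta n))).rel ≤
    (sigma n).rel) (Or.inr ⟨hα, hβ⟩)

theorem sigma_rel_of_eq_mul (h1 : ∃ u ∈ U n, β = u * α) (h2 : ∃ u ∈ U n, α = u * β) :
    (sigma n).rel α β :=
  (le_sup_right : (relativeL (U n)).rel ≤ (sigma n).rel) (relativeL_iff.2 ⟨h1, h2⟩)

end Classes

/-! ### The action on `Ω`: closure, generation and size. -/

section Omega

theorem mul_mem_D (hn : Odd n) {α : Brauer n} (hα : α ∈ D n 1 ∪ D n 3) (β : Brauer n) :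
    α * β ∈ D n 1 ∪ D n 3 := by
  have h1 := rank_mul_le α β
  have h2 : n % 2 = (α * β).1.rank % 2 := rank_modEq (α * β)
  have h3 : α.1.rank = 1 ∨ α.1.rank = 3 := hα
  change (α * β).1.rank = 1 ∨ (α * β).1.rank = 3
  have := Nat.odd_iff.1 hn
  omega

theorem isSubAct_Omega (hn : Odd n) : (sigma n).action.IsSubAct (Omega n) := by
  rintro _ ⟨α, hα, rfl⟩ β
  exact ⟨α * β, mul_mem_D hn hα β, rfl⟩

theorem core_mem_D (hn : Odd n) (hn3 : 3 ≤ n) : core n ∈ D n 1 ∪ D n 3 :=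
  Or.inr (rank_core hn hn3)

theorem faithful_Omega (hn : Odd n) (hn3 : 3 ≤ n) :
    ((sigma n).action.restrict (Omega n) (isSubAct_Omega hn)).Faithful := by
  intro β γ h
  refine eq_of_forall_core_mul hn hn3 fun s => ?_
  have := h ⟨(sigma n).cls (core n * s), _, mul_mem_D hn (core_mem_D hn hn3) s, rfl⟩
  exact Quotient.exact (congrArg Subtype.val this)

theorem exists_uu_zero_one (hn3 : 3 ≤ n) :
    ∃ δ : Brauer n, UU δ ⟨0, by omega⟩ ⟨1, by omega⟩ := by
  refine ⟨ofHooks (Equiv.swap ⟨0, by omega⟩ ⟨1, by omega⟩) fun x => Equiv.swap_apply_self _ _ x,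
    uu_ofHooks.2 (Or.inr ?_)⟩
  simp

theorem exists_sigma_rel_core_mul (hn : Odd n) (hn3 : 3 ≤ n) {α : Brauer n}
    (hα : α ∈ D n 1 ∪ D n 3) : ∃ s, (sigma n).rel (core n * s) α := by
  let o : Fin n := ⟨0, by omega⟩
  let i : Fin n := ⟨1, by omega⟩
  by_cases hK : α ∈ setK (zeta n)
  swap
  -- All of `I` is one class, so any `core n * δ` in `I` will do; a hook `{0, 1}` of `δ` forces
  -- this.
  · obtain ⟨δ, hδ⟩ := exists_uu_zero_one hn3
    refine ⟨δ, sigma_rel_of_mem_setI (fun h => ?_) hK⟩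
    have := uu_zeta.1 (mem_setK.1 h _ _ (hδ.mul_of_ul (ul_core (by simp [label_eq hn]))
      (ul_core (by simp [label_eq hn]))))
    simp [label_eq hn] at this
  -- an element of `U` moves the upper hooks of `α` to those of the core
  obtain ⟨π, h1, h2, h3⟩ : ∃ π : Equiv.Perm (Fin n), (∀ x, π (π x) = x) ∧
      (∀ x, π (kappa n x) = kappa n (π x)) ∧
      ∀ x, 1 < label n x → ∀ y, ¬ UL α (π x) y := by
    by_cases ha : ∃ a p, UL α a p ∧ a ≠ o
    · obtain ⟨a, p, ha, hao⟩ := ha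
      have hr : α.1.rank = 3 :=
        (show α.1.rank = 1 ∨ α.1.rank = 3 from hα).resolve_left fun h =>
          hao (eq_of_rank_eq_one hn hK h (o := o) rfl ha)
      have hfix : ∀ {x}, kappa n x = x → x = o := fun hx => Fin.ext ((kappa_eq_self hn).1 hx)
      obtain ⟨π, h1, h2, h3⟩ := exists_involution_commuting (k := kappa n) (a := a) (c := i)
        kappa_kappa (fun e => hao (hfix e))
        (fun e => by simpa [i, o, Fin.ext_iff] using hfix e)
      refine ⟨π, h1, h2, fun x hx y hy => ?_⟩
      have h4 : π (kappa n i) = kappa n a := by rw [h2, h3]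
      have h5 : π o = o := hfix (by rw [← h2, (kappa_eq_self hn).2 rfl])
      have hi : label n i = 1 := by simp [label_eq hn, i]
      obtain e | e | e := eq_or_eq_or_eq_of_rank_eq_three hn hK hr (o := o) rfl ha hao hy
      · rw [← h5, π.injective.eq_iff] at e
        simp [e, label_eq hn, o] at hx
      · rw [← h3, π.injective.eq_iff] at e
        simp [e, hi] at hx
      · rw [← h4, π.injective.eq_iff] at e
        simp [e, label_kappa, hi] at hx
    -- If the only transversal starts at `o`, all other `κ`-classes are already hooks and nothing
    -- has to be moved.
    · refine ⟨1, fun _ => rfl, fun _ => rfl, fun x hx y hy => ha ⟨x, y, hy, ?_⟩⟩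
      rintro rfl
      simp [label_eq hn, o] at hx
  have hle : LeR (ofPerm π * α) (core n) := by
    rw [leR_iff]
    intro x y h
    by_cases hne : y = x
    · rw [hne]
      exact UU.refl _ _
    by_cases hx : 1 < label n x
    · rw [h.unique (uu_core_kappa hx) hne fun e => ?_, uu_ofPerm_mul h1, h2]
      · exact uu_kappa_of_forall_not_ul hK (h3 x hx)
      · rw [kappa_eq_self hn] at e
        rw [label_eq hn] at hx
        omega
    · exact absurd ((ul_core (not_lt.1 hx)).eq_of_uu h) hne
  obtain ⟨s, hs⟩ := hle
  refine ⟨s, sigma_rel_of_eq_mul ⟨_, ofPerm_mem_U h1 h2, ?_⟩ ⟨_, ofPerm_mem_U h1 h2, hs.symm⟩⟩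
  rw [← hs, ← mul_assoc, ofPerm_mul_self h1, one_mul]

theorem monogenic_Omega (hn : Odd n) (hn3 : 3 ≤ n) :
    ((sigma n).action.restrict (Omega n) (isSubAct_Omega hn)).Monogenic := by
  refine ⟨⟨(sigma n).cls (core n), _, core_mem_D hn hn3, rfl⟩, Set.eq_univ_of_forall ?_⟩
  rintro ⟨_, α, hα, rfl⟩
  obtain ⟨s, hs⟩ := exists_sigma_rel_core_mul hn hn3 hα
  exact Or.inr ⟨_, rfl, s, Subtype.ext (Quotient.sound hs).symm⟩

theorem ncard_Omega_le (hn : Odd n) : (Omega n).ncard ≤ 1 + 3 * p n 3 + p n 1 := by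
  let o : Fin n := ⟨0, hn.pos⟩
  -- An enumeration of the three transversal vertices of each `ε` of rank `3`; for other ranks the
  -- constant value is never used.
  have hidx : ∀ ε : Brauer n, ∃ e : Fin 3 → Fin n, ε.1.rank = 3 →
      ∀ y, (∃ z, UL ε y z) → ∃ i, e i = y := by
    intro ε
    by_cases h : ε.1.rank = 3
    · rw [rank_eq_upper, Set.ncard_eq_three] at h
      obtain ⟨a, b, c, -, -, -, h⟩ := h
      refine ⟨![a, b, c], fun _ y hy => ?_⟩
      obtain rfl | rfl | rfl := (Set.ext_iff.1 h y).1 hy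
      · exact ⟨0, rfl⟩
      · exact ⟨1, rfl⟩
      · exact ⟨2, rfl⟩
    · exact ⟨fun _ => o, fun h' => absurd h' h⟩
  choose e he using hidx
  -- `g1` and `g3` choose a class with the given invariants. Invariants that are not realised get an
  -- arbitrary class, which is harmless since only an upper bound is needed.
  let g1 : Brauer n → (sigma n).Classes := fun ε =>
    (sigma n).cls (Classical.epsilon fun α => α ∈ setK (zeta n) ∧ star α * α = ε)
  let g3 : Brauer n × Fin 3 → (sigma n).Classes := fun q =>
    (sigma n).cls (Classical.epsilon fun α => α ∈ setK (zeta n) ∧ star α * α = q.1 ∧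
      UL α o (e q.1 q.2))
  let A : Set (sigma n).Classes := {ω | ∃ α ∈ setI (zeta n), ω = (sigma n).cls α}
  have hA : A.ncard ≤ 1 := by
    rw [Set.ncard_le_one (Set.toFinite _)]
    rintro _ ⟨α, hα, rfl⟩ _ ⟨β, hβ, rfl⟩
    exact Quotient.sound (sigma_rel_of_mem_setI hα hβ)
  have hsub : Omega n ⊆ A ∪ g3 '' (P n 3 ×ˢ Set.univ) ∪ g1 '' P n 1 := by
    rintro _ ⟨α, hα, rfl⟩
    by_cases hK : α ∈ setK (zeta n)
    swap
    · exact Or.inl (Or.inl ⟨α, hK, rfl⟩)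
    have hP : ∀ r, α.1.rank = r → star α * α ∈ P n r := by
      rintro _ rfl
      exact star_mul_mem_P α
    obtain hr | hr : α.1.rank = 1 ∨ α.1.rank = 3 := hα
    · refine Or.inr ⟨star α * α, hP _ hr, ?_⟩
      obtain ⟨h1, h2⟩ := Classical.epsilon_spec
        (p := fun β => β ∈ setK (zeta n) ∧ star β * β = star α * α) ⟨α, hK, rfl⟩
      refine congrArg _ (eq_of_star_mul_eq hn h1 hK ?_ hr h2)
      rw [← rank_star_mul, h2, rank_star_mul, hr]
    · obtain ⟨y, hy⟩ := exists_ul_of_mem_setK hn hK (o := o) rfl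
      obtain ⟨i, hi⟩ := he (star α * α) ((rank_star_mul α).trans hr) y
        ⟨y, (ul_star.2 hy).mul hy⟩
      have hy' : UL α o (e (star α * α) i) := by rwa [hi]
      refine Or.inl (Or.inr ⟨(star α * α, i), ⟨hP _ hr, trivial⟩, ?_⟩)
      obtain ⟨h1, h2, h3⟩ := Classical.epsilon_spec
        (p := fun β => β ∈ setK (zeta n) ∧ star β * β = star α * α ∧
          UL β o (e (star α * α) i)) ⟨α, hK, rfl, hy'⟩
      have hr' := (rank_star_mul _).symm.trans ((congrArg (fun γ : Brauer n => γ.1.rank) h2).trans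
        ((rank_star_mul α).trans hr))
      exact Quotient.sound (sigma_rel_of_eq_mul
        (exists_mem_U_eq_mul hn h1 hK hr' hr h2 (o := o) rfl h3 hy')
        (exists_mem_U_eq_mul hn hK h1 hr hr' h2.symm (o := o) rfl hy' h3))
  have h3 : (g3 '' (P n 3 ×ˢ Set.univ)).ncard ≤ 3 * p n 3 := by
    refine (Set.ncard_image_le (Set.toFinite _)).trans (le_of_eq ?_)
    rw [Set.ncard_prod, Set.ncard_univ, Nat.card_fin, mul_comm]
    rfl
  have h1 : (g1 '' P n 1).ncard ≤ p n 1 := Set.ncard_image_le (Set.toFinite _)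
  calc (Omega n).ncard ≤ _ := Set.ncard_le_ncard hsub (Set.toFinite _)
    _ ≤ _ := Set.ncard_union_le _ _
    _ ≤ _ := Nat.add_le_add ((Set.ncard_union_le _ _).trans (Nat.add_le_add hA h3)) h1

theorem degRC_le (hn : Odd n) (hn3 : 3 ≤ n) :
    degRC (Brauer n) ≤ ((1 + 3 * p n 3 + p n 1 : ℕ) : ℕ∞) := by
  have : Nonempty (Omega n) := ⟨⟨_, _, core_mem_D hn hn3, rfl⟩⟩
  refine (degRC_le_card _ ?_ (faithful_Omega hn hn3) (monogenic_Omega hn hn3)).trans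
    (Nat.cast_le.2 (ncard_Omega_le hn))
  rintro ⟨_, α, hα, rfl⟩
  exact Subtype.ext (congrArg (sigma n).cls (mul_one α))

end Omega

end Brauer

end DiagramMonoid

theorem theorem6p6 (n : ℕ) (hn : Odd n) (hn3 : 3 ≤ n) :
    (∃ hΩ : (DiagramMonoid.Brauer.sigma n).action.IsSubAct (DiagramMonoid.Brauer.Omega n),
      ((DiagramMonoid.Brauer.sigma n).action.restrict (DiagramMonoid.Brauer.Omega n) hΩ).Faithful ∧
      ((DiagramMonoid.Brauer.sigma n).action.restrict
        (DiagramMonoid.Brauer.Omega n) hΩ).Monogenic) ∧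
    DiagramMonoid.deg (DiagramMonoid.Brauer n) ≤ DiagramMonoid.degRC (DiagramMonoid.Brauer n) ∧
    DiagramMonoid.degRC (DiagramMonoid.Brauer n) ≤
      ((1 + 3 * DiagramMonoid.Brauer.p n 3 + DiagramMonoid.Brauer.p n 1 : ℕ) : ℕ∞) :=
  ⟨⟨DiagramMonoid.Brauer.isSubAct_Omega hn, DiagramMonoid.Brauer.faithful_Omega hn hn3,
      DiagramMonoid.Brauer.monogenic_Omega hn hn3⟩,
    DiagramMonoid.deg_le_degRC _, DiagramMonoid.Brauer.degRC_le hn hn3⟩
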